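/- Consider $N$ access points (APs) and $M$ clients. Time is slotted, and the time-slots are grouped into consecutive intervals of $\tau$ time-slots. A transmission from AP $i$ to client $j$ in a time-slot succeeds with probability $p_{ij}\in[0,1]$ ($p_{ij}=0$ if there is no link), independently over time-slots and over pairs $(i,j)$. In every interval each client requests one new packet; before the interval each packet is assigned to one AP, and in each time-slot each AP may transmit one of the packets assigned to it that are not yet delivered, and then learns whether it was delivered; packets not delivered by the end of the interval are dropped. A scheduling policy $\eta$ makes all these decisions causally, from the past history. Let $N_j(k,\eta)\in\{0,1\}$ indicate whether client $j$ receives its packet in interval $k$, and let $$\mathsf T^3(\eta)=\limsup_{r\to\infty}\frac1r\sum_{k=1}^r\sum_{j=1}^M N_j(k,\eta),\qquad R_j(\eta)=\limsup_{r\to\infty}\frac1r\sum_{k=1}^r N_j(k,\eta),$$ where the value of such a (random) limit superior is the largest number $R$ such that it is at least $R$ with probability $1$. Let $C_{\mathsf T^3}=\sup_\eta \mathsf T^3(\eta)$ over all scheduling policies. Let $x^*=[x^*_{ij}]$ be a basic optimal solution of the linear program $$\max\sum_{i=1}^N\sum_{j=1}^M x_{ij}\quad\text{s.t.}\quad \sum_{j=1}^M\frac{x_{ij}}{p_{ij}}\le\tau\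 (1\le i\le N),\qquad \sum_{i=1}^N x_{ij}\le 1\ (1\le j\le M),\qquad x_{ij}\ge 0,$$ where $x_{ij}=0$ is required if $p_{ij}=0$. Assign client $j$ to AP $i$ whenever $\lfloor x^*_{ij}\rfloor=1$, and assign the remaining clients to APs arbitrarily. Let $\eta^{\mathrm{apx}}_{\mathrm{det}}$ be a corresponding greedy static policy: this assignment is used in all intervals, and each AP serves its clients in decreasing order of $p_{ij}$ (ties broken arbitrarily), transmitting each packet until it is delivered before moving on to the next one. If $C_{\mathsf T^3}>\frac{11N}{4}$, then $$C_{\mathsf T^3}-2N-2\sqrt{N\Bigl(C_{\mathsf T^3}-\frac{7N}{4}\Bigr)}\ \le\ \bigl\|\vec R(\eta^{\mathrm{apx}}_{\mathrm{det}})\bigr\|_1=\sum_{j=1}^M R_j(\eta^{\mathrm{apx}}_{\mathrm{det}})\ \le\ C_{\mathsf T^3}.$$ -/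

import Mathlib

open MeasureTheory ProbabilityTheory Filter

namespace TimelyThroughput

/-! ### Scheduling policies -/

/-- An assignment of the packets of the `M` clients (one packet per client and interval) to the
`N` access points. Its fibres are the sets `I_1, …, I_N` partitioning the clients. -/
abbrev Assignment (N M : ℕ) := Fin M → Fin N

/-- What happens in one time-slot: for each access point, either `none` (it is idle) or
`some (j, b)`: it transmits the packet of client `j`, and `b` tells if the packet is delivered. -/
abbrev SlotRecord (N M : ℕ) := Fin N → Option (Fin M × Bool)

/-- What happens in one interval: the assignment used, and the records of its time-slots in
chronological order. -/
abbrev IntervalRecord (N M : ℕ) := Assignment N M × List (SlotRecord N M)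

/-- The packet of client `j` has been delivered in one of the given time-slots. -/
def Delivered {N M : ℕ} (cur : List (SlotRecord N M)) (j : Fin M) : Prop :=
  ∃ s ∈ cur, ∃ i : Fin N, s i = some (j, true)

instance {N M : ℕ} (cur : List (SlotRecord N M)) (j : Fin M) : Decidable (Delivered cur j) :=
  inferInstanceAs (Decidable (∃ s ∈ cur, ∃ i : Fin N, s i = some (j, true)))

/-- A (causal) scheduling policy. Before an interval it chooses an assignment from the records of
all past intervals. In a time-slot it chooses, for each access point, what to transmit (`none`: the
access point stays idle) from the records of the past intervals, the assignment of the current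
interval, and the records of the earlier time-slots of the current interval. An access point
transmits only packets that are assigned to it and have not been delivered yet. -/
structure SchedulingPolicy (N M : ℕ) where
  assign : List (IntervalRecord N M) → Assignment N M
  transmit : List (IntervalRecord N M) → Assignment N M → List (SlotRecord N M) →
    Fin N → Option (Fin M)
  transmit_pending : ∀ past A cur i j, transmit past A cur i = some j →
    A j = i ∧ ¬ Delivered cur j

/-- The records of the first `t` time-slots of an interval run under the policy `η` after the past
intervals `past`, where `x s i j` tells if the channel from access point `i` to client `j` is
successful in the `s`-th time-slot of this interval. -/
def SchedulingPolicy.runInterval {N M : ℕ} (η : SchedulingPolicy N M)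
    (past : List (IntervalRecord N M)) (x : ℕ → Fin N → Fin M → Bool) :
    ℕ → List (SlotRecord N M)
  | 0 => []
  | t + 1 =>
    η.runInterval past x t ++
      [fun i => (η.transmit past (η.assign past) (η.runInterval past x t) i).map
        fun j => (j, x t i j)]

/-- The records of the first `k` intervals under the policy `η`, where an interval has `τ`
time-slots and `x n i j` tells if the channel from access point `i` to client `j` is successful in
time-slot `n` (time-slots are numbered `0, 1, 2, …`; interval `k` consists of the time-slots
`k * τ, …, k * τ + τ - 1`). -/
def SchedulingPolicy.history {N M : ℕ} (η : SchedulingPolicy N M) (τ : ℕ)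
    (x : ℕ → Fin N → Fin M → Bool) : ℕ → List (IntervalRecord N M)
  | 0 => []
  | k + 1 =>
    η.history τ x k ++
      [(η.assign (η.history τ x k),
        η.runInterval (η.history τ x k) (fun t => x (k * τ + t)) τ)]

/-- `N_j(k, η)`: it is `1` if client `j` receives its packet during interval `k`
(`k = 0, 1, 2, …`), and `0` otherwise. -/
def SchedulingPolicy.delivery {N M : ℕ} (η : SchedulingPolicy N M) (τ : ℕ)
    (x : ℕ → Fin N → Fin M → Bool) (k : ℕ) (j : Fin M) : ℕ :=
  if Delivered (η.runInterval (η.history τ x k) (fun t => x (k * τ + t)) τ) j then 1 else 0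

/-- The static scheduling policy given by an assignment `A` and an order of service `Γ i` for each
access point `i` (`Γ i 0, Γ i 1, …` lists the clients; only those assigned to `i` matter): in each
time-slot access point `i` transmits the first packet in this order that is assigned to it and not
yet delivered, so a packet is transmitted persistently until it is delivered. -/
def staticPolicy {N M : ℕ} (A : Assignment N M) (Γ : Fin N → Equiv.Perm (Fin M)) :
    SchedulingPolicy N M where
  assign _ := A
  transmit _ B cur i := (List.ofFn (Γ i)).find? fun j => decide (B j = i ∧ ¬ Delivered cur j)
  transmit_pending _ _ _ _ _ h := by simpa using List.find?_some h

/-- The order of service `Γ` is greedy for the assignment `A`: each access point serves its clients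
in decreasing order of the channel success probabilities (ties are broken in any way). -/
def IsGreedy {N M : ℕ} (p : Fin N → Fin M → ℝ) (A : Assignment N M)
    (Γ : Fin N → Equiv.Perm (Fin M)) : Prop :=
  ∀ (i : Fin N) (a b : Fin M), a < b → A (Γ i a) = i → A (Γ i b) = i →
    p i (Γ i b) ≤ p i (Γ i a)

/-! ### Channels and timely throughput -/

/-- `X n i j ω` tells if the erasure channel from access point `i` to client `j` is successful in
time-slot `n`. All channel uses, over time and over channels, are independent, and the success
probability of the channel from `i` to `j` is `p i j` in every time-slot. -/
structure IsErasureNetwork {Ω : Type*} [MeasurableSpace Ω] {N M : ℕ} (μ : Measure Ω)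
    (p : Fin N → Fin M → ℝ) (X : ℕ → Fin N → Fin M → Ω → Bool) : Prop where
  measurable : ∀ n i j, Measurable (X n i j)
  indep : iIndepFun (fun s : ℕ × Fin N × Fin M => X s.1 s.2.1 s.2.2) μ
  success : ∀ n i j, μ {ω | X n i j ω = true} = ENNReal.ofReal (p i j)

/-- The almost sure value of the limit superior of a sequence of random variables: the largest `R`
such that the limit superior is at least `R` with probability one. -/
noncomputable def asLimsup {Ω : Type*} [MeasurableSpace Ω] (μ : Measure Ω) (f : ℕ → Ω → ℝ) : ℝ :=
  sSup {R : ℝ | ∀ᵐ ω ∂μ, R ≤ limsup (fun r => f r ω) atTop}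

/-- The total timely throughput `T³(η)`. -/
noncomputable def totalThroughput {Ω : Type*} [MeasurableSpace Ω] {N M : ℕ} (μ : Measure Ω)
    (τ : ℕ) (X : ℕ → Fin N → Fin M → Ω → Bool) (η : SchedulingPolicy N M) : ℝ :=
  asLimsup μ fun r ω =>
    (∑ k ∈ Finset.range r, ∑ j : Fin M, (η.delivery τ (fun n i j => X n i j ω) k j : ℝ)) / r

/-- The timely throughput `R_j(η)` of client `j`. -/
noncomputable def clientThroughput {Ω : Type*} [MeasurableSpace Ω] {N M : ℕ} (μ : Measure Ω)
    (τ : ℕ) (X : ℕ → Fin N → Fin M → Ω → Bool) (η : SchedulingPolicy N M) (j : Fin M) : ℝ :=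
  asLimsup μ fun r ω =>
    (∑ k ∈ Finset.range r, (η.delivery τ (fun n i j => X n i j ω) k j : ℝ)) / r

/-- The `ℓ¹` norm of the vector of timely throughputs of the clients. -/
noncomputable def throughputNorm {Ω : Type*} [MeasurableSpace Ω] {N M : ℕ} (μ : Measure Ω)
    (τ : ℕ) (X : ℕ → Fin N → Fin M → Ω → Bool) (η : SchedulingPolicy N M) : ℝ :=
  ∑ j : Fin M, |clientThroughput μ τ X η j|

/-- The largest achievable total timely throughput: the supremum over all scheduling policies. -/
noncomputable def capacity {Ω : Type*} [MeasurableSpace Ω] {N M : ℕ} (μ : Measure Ω)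
    (τ : ℕ) (X : ℕ → Fin N → Fin M → Ω → Bool) : ℝ :=
  ⨆ η : SchedulingPolicy N M, totalThroughput μ τ X η

/-! ### The linear programming relaxation -/

/-- Feasible points of the linear relaxation of the packing problem: client `j` has size
`1 / p i j` in bin `i`, and every bin has capacity `τ`. The size is infinite if `p i j = 0`, which
forces `x i j = 0`; this is stated separately because `1 / 0 = 0` here. -/
structure LPFeasible {N M : ℕ} (p : Fin N → Fin M → ℝ) (τ : ℕ) (x : Fin N → Fin M → ℝ) :
    Prop where
  nonneg : ∀ i j, 0 ≤ x i j
  no_link : ∀ i j, p i j = 0 → x i j = 0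
  bin : ∀ i, ∑ j, x i j / p i j ≤ τ
  client : ∀ j, ∑ i, x i j ≤ 1

/-- The coefficient vectors of the constraints of the linear program that hold with equality at `x`
(the constraints `x i j ≥ 0`, which include the constraints `x i j = 0` of missing links; the bin
constraints; the client constraints). -/
def tightConstraints {N M : ℕ} (p : Fin N → Fin M → ℝ) (τ : ℕ) (x : Fin N → Fin M → ℝ) :
    Set (Fin N → Fin M → ℝ) :=
  {a | ∃ i j, x i j = 0 ∧ a = fun i' j' => if i' = i ∧ j' = j then 1 else 0} ∪
  {a | ∃ i, ∑ j, x i j / p i j = τ ∧ a = fun i' j' => if i' = i then 1 / p i j' else 0} ∪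
  {a | ∃ j, ∑ i, x i j = 1 ∧ a = fun _ j' => if j' = j then 1 else 0}

/-- `x` is a basic optimal solution of the linear program: it is feasible, as many linearly
independent constraints are tight at `x` as there are variables (that is, the tight constraints
span the whole space), and `x` maximizes the objective `∑ i, ∑ j, x i j`. -/
structure IsBasicOptimal {N M : ℕ} (p : Fin N → Fin M → ℝ) (τ : ℕ) (x : Fin N → Fin M → ℝ) :
    Prop where
  feasible : LPFeasible p τ x
  basic : Submodule.span ℝ (tightConstraints p τ x) = ⊤
  optimal : ∀ y, LPFeasible p τ y → ∑ i, ∑ j, y i j ≤ ∑ i, ∑ j, x i j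

/-- The assignment `A` is the one suggested by the rounded down values `⌊x i j⌋`: client `j` is
assigned to `i` whenever `⌊x i j⌋ = 1`. The remaining clients are assigned arbitrarily. -/
def SuggestedBy {N M : ℕ} (x : Fin N → Fin M → ℝ) (A : Assignment N M) : Prop :=
  ∀ i j, ⌊x i j⌋ = 1 → A j = i

end TimelyThroughput

open TimelyThroughput

/-! Let `L` be the value of the linear program and `C` the capacity.

Relaxation, `C ≤ L`. Fix a policy and the past of an interval. The decision in a time-slot is
independent of the channels in that slot, so the expected number of deliveries from `i` to `j` is `p
i j` times the expected number of transmissions. These products form a feasible point of the linear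
program, so the conditional mean of the deliveries in an interval is at most `L`
(`integral_sum_deliveredInd_le`). Deviations from the conditional means are bounded and orthogonal,
hence average out almost surely (`ae_tendsto_average_sub`). For a static policy the conditional
means are constant: all limits exist, the norm equals the total throughput, and the upper bound by
`C` follows.

Rounding. At a basic solution the tight constraints span the space; counting them shows that the
entries equal to `1` make up at least `L - N` (`IsBasicOptimal.sum_le`).

Loss at one access point. Suppose `n` of its clients fit into its bin. By an exchange argument, so
do the first `n` in greedy order, whose mean service times `1 / p` increase. When client `k` (from
`0`) is due, the remaining `n - 1 - k` clients leave a slack of at least `(n - 1 - k) / p`, while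
the variance is at most `(k + 1) / p ^ 2`, with `p` that of client `k`. Chebyshev's inequality
bounds the loss probability by `(k + 1) / (n - 1 - k) ^ 2`. Summing, with the trivial bound `1` for
the last clients, gives a loss of at most `1 + c + (n - 3 / 4) / c` for every `c ≥ 1`
(`sum_le_of_mul_sq_le`).

Since this is affine in `n`, the same `c` can be used for all access points and the bounds add up
without a convexity argument; `c = √((C - 7 * N / 4) / N)` gives the claim. -/

namespace TimelyThroughput

/-! ### Independence of disjoint sets of time-slots -/

/-- The realization of all channels. -/
def channelPath {Ω : Type*} {N M : ℕ} (X : ℕ → Fin N → Fin M → Ω → Bool) (ω : Ω) :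
    ℕ → Fin N → Fin M → Bool := fun n i j => X n i j ω

/-- A configuration of the channels in finitely many time-slots, extended by failures. -/
def extendConfig {N M : ℕ} (S : Finset ℕ) (a : S → Fin N → Fin M → Bool) :
    ℕ → Fin N → Fin M → Bool := fun n => if h : n ∈ S then a ⟨n, h⟩ else fun _ _ => false

section Independence

variable {Ω : Type*} [MeasurableSpace Ω] {μ : Measure Ω} {N M : ℕ}
  {p : Fin N → Fin M → ℝ} {X : ℕ → Fin N → Fin M → Ω → Bool}

theorem IsErasureNetwork.measurable_restrict (hX : IsErasureNetwork μ p X) (S : Finset ℕ) :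
    Measurable fun ω (n : S) => channelPath X ω n :=
  measurable_pi_lambda _ fun n => measurable_pi_lambda _ fun i => measurable_pi_lambda _ fun j =>
    hX.measurable n i j

/-- Disjoint sets of time-slots involve disjoint subfamilies of the independent channel uses. -/
theorem IsErasureNetwork.indepFun_restrict (hX : IsErasureNetwork μ p X) {S T : Finset ℕ}
    (hST : Disjoint S T) :
    IndepFun (fun ω (n : S) => channelPath X ω n) (fun ω (n : T) => channelPath X ω n) μ := by
  have key := hX.indep.indepFun_finset (S ×ˢ (Finset.univ : Finset (Fin N × Fin M)))
    (T ×ˢ (Finset.univ : Finset (Fin N × Fin M)))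
    (by
      rw [Finset.disjoint_left] at hST ⊢
      intro a ha hb
      simp only [Finset.mem_product, Finset.mem_univ, and_true] at ha hb
      exact hST ha hb) (fun s => hX.measurable s.1 s.2.1 s.2.2)
  exact key.comp
    (φ := fun a (n : S) i j => a ⟨(n, i, j), by simp⟩)
    (ψ := fun a (n : T) i j => a ⟨(n, i, j), by simp⟩)
    (measurable_of_countable _) (measurable_of_countable _)

theorem IsErasureNetwork.measurable_of_dependsOn (hX : IsErasureNetwork μ p X) {S : Finset ℕ}
    {f : (ℕ → Fin N → Fin M → Bool) → ℝ} (hf : DependsOn f S) :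
    Measurable fun ω => f (channelPath X ω) := by
  have : (fun ω => f (channelPath X ω)) =
      (fun a => f (extendConfig S a)) ∘ fun ω (n : S) => channelPath X ω n := by
    funext ω
    refine hf fun n hn => ?_
    have hn' : n ∈ S := hn
    simp [extendConfig, hn']
  rw [this]
  exact (measurable_of_countable _).comp (hX.measurable_restrict S)

variable [IsProbabilityMeasure μ]

theorem IsErasureNetwork.integrable_of_dependsOn (hX : IsErasureNetwork μ p X) {S : Finset ℕ}
    {f : (ℕ → Fin N → Fin M → Bool) → ℝ} (hf : DependsOn f S) :
    Integrable (fun ω => f (channelPath X ω)) μ := by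
  have : (fun ω => f (channelPath X ω)) =
      (fun a => f (extendConfig S a)) ∘ fun ω (n : S) => channelPath X ω n := by
    funext ω
    refine hf fun n hn => ?_
    have hn' : n ∈ S := hn
    simp [extendConfig, hn']
  rw [this]
  have := Measure.isProbabilityMeasure_map (μ := μ) (hX.measurable_restrict S).aemeasurable
  exact (Integrable.of_finite).comp_measurable (hX.measurable_restrict S)

/-- Channel realizations in disjoint sets of time-slots may be integrated separately. -/
theorem IsErasureNetwork.integral_eq_integral_integral (hX : IsErasureNetwork μ p X)
    {S T : Finset ℕ} (hST : Disjoint S T)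
    {F : (ℕ → Fin N → Fin M → Bool) → (ℕ → Fin N → Fin M → Bool) → ℝ}
    (hS : ∀ y, DependsOn (fun x => F x y) (S : Set ℕ)) (hT : ∀ x, DependsOn (F x) (T : Set ℕ)) :
    ∫ ω, F (channelPath X ω) (channelPath X ω) ∂μ =
      ∫ ω, ∫ ω', F (channelPath X ω) (channelPath X ω') ∂μ ∂μ := by
  set U := fun ω (n : S) => channelPath X ω n
  set V := fun ω (n : T) => channelPath X ω n
  have hU : Measurable U := hX.measurable_restrict S
  have hV : Measurable V := hX.measurable_restrict T
  set G := fun a b => F (extendConfig S a) (extendConfig T b)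
  have hFG : ∀ ω ω', F (channelPath X ω) (channelPath X ω') = G (U ω) (V ω') := by
    intro ω ω'
    refine (hS _ fun n hn => ?_).trans (hT _ fun n hn => ?_) <;>
    · rw [Finset.mem_coe] at hn
      simp [extendConfig, hn, U, V]
  have hUP := Measure.isProbabilityMeasure_map (μ := μ) hU.aemeasurable
  have hVP := Measure.isProbabilityMeasure_map (μ := μ) hV.aemeasurable
  simp_rw [hFG]
  have hmap := (indepFun_iff_map_prod_eq_prod_map_map hU.aemeasurable hV.aemeasurable).1
    (hX.indepFun_restrict hST)
  calc ∫ ω, G (U ω) (V ω) ∂μ = ∫ z, G z.1 z.2 ∂(μ.map fun ω => (U ω, V ω)) :=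
        (integral_map (f := fun z => G z.1 z.2) (hU.prodMk hV).aemeasurable
          (measurable_of_countable _).aestronglyMeasurable).symm
    _ = ∫ a, ∫ b, G a b ∂(μ.map V) ∂(μ.map U) := by
        rw [hmap]; exact integral_prod _ Integrable.of_finite
    _ = ∫ ω, ∫ b, G (U ω) b ∂(μ.map V) ∂μ :=
        integral_map hU.aemeasurable (measurable_of_countable _).aestronglyMeasurable
    _ = ∫ ω, ∫ ω', G (U ω) (V ω') ∂μ ∂μ := by
        congr 1; funext ω
        exact integral_map hV.aemeasurable (measurable_of_countable _).aestronglyMeasurable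

theorem IsErasureNetwork.integral_channel (hX : IsErasureNetwork μ p X)
    (hp : ∀ i j, 0 ≤ p i j ∧ p i j ≤ 1) (n : ℕ) (i : Fin N) (j : Fin M) (f : Bool → ℝ) :
    ∫ ω, f (channelPath X ω n i j) ∂μ = p i j * f true + (1 - p i j) * f false := by
  have hm : MeasurableSet {ω | X n i j ω = true} := hX.measurable n i j (MeasurableSet.singleton _)
  have h : ∀ ω, f (channelPath X ω n i j) =
      Set.indicator {ω | X n i j ω = true} (fun _ => f true - f false) ω + f false := by
    intro ω
    by_cases h : X n i j ω = true <;> simp [channelPath, Set.indicator, h]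
  simp_rw [h]
  rw [integral_add ((integrable_const _).indicator hm) (integrable_const _),
    integral_indicator_const _ hm, Measure.real, hX.success,
    ENNReal.toReal_ofReal (hp i j).1]
  simp
  ring

end Independence

/-! ### A law of large numbers for bounded orthogonal random variables -/

theorem integral_sq_sum_le_of_orthogonal {Ω : Type*} [MeasurableSpace Ω] {μ : Measure Ω}
    [IsProbabilityMeasure μ] {D : ℕ → Ω → ℝ} {c : ℝ} (hD : ∀ k, Measurable (D k))
    (hc : ∀ k ω, |D k ω| ≤ c) (horth : ∀ k l, l < k → ∫ ω, D k ω * D l ω ∂μ = 0) (r : ℕ) :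
    ∫ ω, (∑ k ∈ Finset.range r, D k ω) ^ 2 ∂μ ≤ r * c ^ 2 := by
  have hint : ∀ k l, Integrable (fun ω => D k ω * D l ω) μ := fun k l =>
    Integrable.of_bound ((hD k).mul (hD l)).aestronglyMeasurable (c * c)
      (ae_of_all _ fun ω => by
        rw [Real.norm_eq_abs, abs_mul]
        exact mul_le_mul (hc k ω) (hc l ω) (abs_nonneg _) ((abs_nonneg _).trans (hc k ω)))
  induction r with
  | zero => simp
  | succ r ih =>
    have h : ∀ ω, (∑ k ∈ Finset.range (r + 1), D k ω) ^ 2 =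
        (∑ k ∈ Finset.range r, D k ω) ^ 2 + 2 * (∑ l ∈ Finset.range r, D r ω * D l ω) +
          D r ω * D r ω := by
      intro ω
      rw [Finset.sum_range_succ, ← Finset.mul_sum]
      ring
    have hsq : Integrable (fun ω => (∑ k ∈ Finset.range r, D k ω) ^ 2) μ := by
      have : (fun ω => (∑ k ∈ Finset.range r, D k ω) ^ 2) = fun ω =>
          ∑ k ∈ Finset.range r, ∑ l ∈ Finset.range r, D k ω * D l ω := by
        funext ω
        rw [sq, Finset.sum_mul_sum]
      rw [this]
      exact integrable_finsetSum _ fun k _ => integrable_finsetSum _ fun l _ => hint k l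
    have hcross : Integrable (fun ω => 2 * ∑ l ∈ Finset.range r, D r ω * D l ω) μ :=
      (integrable_finsetSum _ fun l _ => hint r l).const_mul 2
    simp_rw [h]
    have hadd : Integrable (fun ω => (∑ k ∈ Finset.range r, D k ω) ^ 2 +
        2 * ∑ l ∈ Finset.range r, D r ω * D l ω) μ := hsq.add hcross
    rw [integral_add hadd (hint r r), integral_add hsq hcross, integral_const_mul,
      integral_finsetSum _ fun l _ => hint r l,
      Finset.sum_eq_zero fun l hl => horth r l (Finset.mem_range.1 hl)]
    have hlast : ∫ ω, D r ω * D r ω ∂μ ≤ c ^ 2 := by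
      refine (integral_mono (hint r r) (integrable_const (c ^ 2)) fun ω => ?_).trans (by simp)
      have := hc r ω
      simp only
      rw [← sq, ← sq_abs]
      exact pow_le_pow_left₀ (abs_nonneg _) this 2
    push_cast
    linarith

/-- Orthogonality makes the second moment of the average over `n ^ 2` terms at most `c ^ 2 / n ^ 2`,
which is summable, so the averages along squares vanish almost surely. Boundedness fills the gaps
between consecutive squares. -/
theorem ae_tendsto_average_of_orthogonal {Ω : Type*} [MeasurableSpace Ω] {μ : Measure Ω}
    [IsProbabilityMeasure μ] {D : ℕ → Ω → ℝ} {c : ℝ} (hD : ∀ k, Measurable (D k))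
    (hc : ∀ k ω, |D k ω| ≤ c) (horth : ∀ k l, l < k → ∫ ω, D k ω * D l ω ∂μ = 0) :
    ∀ᵐ ω ∂μ, Tendsto (fun r : ℕ => (∑ k ∈ Finset.range r, D k ω) / r) atTop (nhds 0) := by
  set S : ℕ → Ω → ℝ := fun r ω => ∑ k ∈ Finset.range r, D k ω with hSdef
  have hSm : ∀ r, Measurable (S r) := fun r => Finset.measurable_sum _ fun k _ => hD k
  have hSb : ∀ r ω, |S r ω| ≤ r * c := fun r ω => by
    refine (Finset.abs_sum_le_sum_abs _ _).trans ((Finset.sum_le_sum fun k _ => hc k ω).trans ?_)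
    simp
  set Z : ℕ → Ω → ℝ := fun n ω => (S (n ^ 2) ω / (n ^ 2 : ℕ)) ^ 2 with hZdef
  have hZm : ∀ n, Measurable (Z n) := fun n => ((hSm _).div_const _).pow_const 2
  have hZ0 : ∀ n ω, 0 ≤ Z n ω := fun n ω => sq_nonneg _
  have hSint : ∀ r, Integrable (fun ω => (S r ω) ^ 2) μ := fun r =>
    Integrable.of_bound ((hSm r).pow_const 2).aestronglyMeasurable ((r * c) ^ 2)
      (ae_of_all _ fun ω => by
        rw [Real.norm_eq_abs, abs_pow]
        exact pow_le_pow_left₀ (abs_nonneg _) (hSb r ω) 2)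
  have hZi : ∀ n, ∫ ω, Z n ω ∂μ ≤ c ^ 2 * (1 / (n : ℝ) ^ 2) := by
    intro n
    have h1 := integral_sq_sum_le_of_orthogonal hD hc horth (n ^ 2)
    have h2 : ∫ ω, Z n ω ∂μ = (∫ ω, (S (n ^ 2) ω) ^ 2 ∂μ) / ((n ^ 2 : ℕ) : ℝ) ^ 2 := by
      rw [← integral_div]
      simp only [hZdef, div_pow]
    rw [h2]
    rcases Nat.eq_zero_or_pos n with rfl | hn
    · simp
    · have hn' : (0 : ℝ) < n := by exact_mod_cast hn
      rw [div_le_iff₀ (by positivity)]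
      refine h1.trans (le_of_eq ?_)
      push_cast
      field_simp
  have hsum : ∀ᵐ ω ∂μ, Summable fun n => Z n ω := by
    have hfin : ∑' n, ∫⁻ ω, ENNReal.ofReal (Z n ω) ∂μ ≠ ⊤ := by
      have hle : ∀ n, ∫⁻ ω, ENNReal.ofReal (Z n ω) ∂μ ≤
          ENNReal.ofReal (c ^ 2 * (1 / (n : ℝ) ^ 2)) := by
        intro n
        rw [← ofReal_integral_eq_lintegral_ofReal _ (ae_of_all _ (hZ0 n))]
        · exact ENNReal.ofReal_le_ofReal (hZi n)
        · have := (hSint (n ^ 2)).div_const (((n ^ 2 : ℕ) : ℝ) ^ 2)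
          simpa only [hZdef, div_pow] using this
      refine ne_top_of_le_ne_top ?_ (ENNReal.tsum_le_tsum hle)
      have hs : Summable fun n : ℕ => c ^ 2 * (1 / (n : ℝ) ^ 2) :=
        (Real.summable_one_div_nat_pow.2 one_lt_two).mul_left _
      rw [← ENNReal.ofReal_tsum_of_nonneg (fun n => by positivity) hs]
      exact ENNReal.ofReal_ne_top
    rw [← lintegral_tsum fun n => (hZm n).ennreal_ofReal.aemeasurable] at hfin
    filter_upwards [ae_lt_top (Measurable.tsum fun n => (hZm n).ennreal_ofReal) hfin]
      with ω hω
    have := ENNReal.summable_toReal hω.ne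
    simpa only [ENNReal.toReal_ofReal (hZ0 _ ω)] using this
  filter_upwards [hsum] with ω hω
  have hsq : Tendsto (fun n : ℕ => S (n ^ 2) ω / (n ^ 2 : ℕ)) atTop (nhds 0) := by
    have h := hω.tendsto_atTop_zero
    have h2 := (Real.continuous_sqrt.tendsto 0).comp h
    simp only [Function.comp_def, hZdef, Real.sqrt_sq_eq_abs, Real.sqrt_zero] at h2
    exact (tendsto_zero_iff_abs_tendsto_zero _).2 h2
  -- Adding `c` to every term makes the partial sums monotone, so that convergence along the
  -- squares, whose successive ratios tend to `1`, implies convergence of the whole sequence.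
  have hmono : Monotone fun r : ℕ => S r ω + r * c := by
    refine monotone_nat_of_le_succ fun r => ?_
    have := (abs_le.1 (hc r ω)).1
    simp only [hSdef, Finset.sum_range_succ]
    push_cast
    linarith
  have hlim := tendsto_div_of_monotone_of_exists_subseq_tendsto_div
    (fun r : ℕ => S r ω + r * c) c hmono (fun a ha => ⟨fun n => n ^ 2, ?_, ?_, ?_⟩)
  · have h2 : Tendsto (fun r : ℕ => (S r ω + r * c) / r - c) atTop (nhds (c - c)) :=
      hlim.sub_const c
    rw [sub_self] at h2
    refine h2.congr' ?_
    filter_upwards [eventually_gt_atTop 0] with r hr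
    have : (r : ℝ) ≠ 0 := by exact_mod_cast hr.ne'
    field_simp
    simp [hSdef]
  · have h1 : Tendsto (fun n : ℕ => (1 + 1 / (n : ℝ)) ^ 2) atTop (nhds ((1 + 0) ^ 2)) :=
      (tendsto_one_div_atTop_nhds_zero_nat.const_add 1).pow 2
    have h2 := h1.eventually_lt_const (u := a) (by simpa using ha)
    filter_upwards [h2, eventually_gt_atTop 0] with n hn hn0
    have hn' : (0 : ℝ) < n := by exact_mod_cast hn0
    have : (((n + 1) ^ 2 : ℕ) : ℝ) = (1 + 1 / (n : ℝ)) ^ 2 * (n : ℝ) ^ 2 := by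
      push_cast
      field_simp
    rw [this]
    push_cast
    exact mul_le_mul_of_nonneg_right hn.le (by positivity)
  · exact tendsto_pow_atTop two_ne_zero
  · have h2 : Tendsto (fun n : ℕ => S (n ^ 2) ω / (n ^ 2 : ℕ) + c) atTop (nhds (0 + c)) :=
      hsq.add_const c
    rw [zero_add] at h2
    refine h2.congr' ?_
    filter_upwards [eventually_gt_atTop 0] with n hn
    have : (((n ^ 2 : ℕ)) : ℝ) ≠ 0 := by positivity
    field_simp

/-! ### Intervals run under a policy -/

namespace SchedulingPolicy

variable {N M : ℕ} (η : SchedulingPolicy N M)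

theorem runInterval_congr (past : List (IntervalRecord N M)) {x y : ℕ → Fin N → Fin M → Bool}
    {t : ℕ} (h : ∀ s < t, x s = y s) : η.runInterval past x t = η.runInterval past y t := by
  induction t with
  | zero => rfl
  | succ t ih =>
    simp only [runInterval, ih fun s hs => h s (hs.trans t.lt_succ_self), h t t.lt_succ_self]

theorem history_congr (τ : ℕ) {x y : ℕ → Fin N → Fin M → Bool} {k : ℕ}
    (h : ∀ n < k * τ, x n = y n) : η.history τ x k = η.history τ y k := by
  induction k with
  | zero => rfl
  | succ k ih =>
    have h1 : η.history τ x k = η.history τ y k := ih fun n hn => h n (by rw [Nat.succ_mul]; omega)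
    simp only [history, h1]
    rw [η.runInterval_congr (η.history τ y k) (y := fun t => y (k * τ + t)) fun s hs =>
      h _ (by rw [Nat.succ_mul]; omega)]

/-- The records of interval `k` under the policy `η` after the past intervals `past`. -/
def interval (τ k : ℕ) (past : List (IntervalRecord N M)) (x : ℕ → Fin N → Fin M → Bool) :
    List (SlotRecord N M) :=
  η.runInterval past (fun t => x (k * τ + t)) τ

theorem interval_congr {τ k : ℕ} (past : List (IntervalRecord N M))
    {x y : ℕ → Fin N → Fin M → Bool} (h : ∀ n ∈ Finset.Ico (k * τ) (k * τ + τ), x n = y n) :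
    η.interval τ k past x = η.interval τ k past y :=
  η.runInterval_congr past fun s hs => h _ (by simp [hs])

end SchedulingPolicy

/-! ### Martingale differences of interval rewards, and stationarity of the channels -/

section Averages

variable {Ω : Type*} [MeasurableSpace Ω] {μ : Measure Ω} [IsProbabilityMeasure μ] {N M : ℕ}
  {p : Fin N → Fin M → ℝ} {X : ℕ → Fin N → Fin M → Ω → Bool}

/-- The time averages of a reward that depends on the current interval and of its conditional
expectations given the past intervals have the same asymptotics. -/
theorem IsErasureNetwork.ae_tendsto_average_sub (hX : IsErasureNetwork μ p X)
    (η : SchedulingPolicy N M) (τ : ℕ) (φ : List (SlotRecord N M) → ℝ) {c : ℝ}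
    (hφ : ∀ l, |φ l| ≤ c) :
    ∀ᵐ ω ∂μ, Tendsto (fun r : ℕ => (∑ k ∈ Finset.range r,
      (φ (η.interval τ k (η.history τ (channelPath X ω) k) (channelPath X ω)) -
        ∫ ω', φ (η.interval τ k (η.history τ (channelPath X ω) k) (channelPath X ω')) ∂μ)) / r)
      atTop (nhds 0) := by
  -- `x` carries the past and `y` the current interval. Integrating over a fresh `ω'` with the past
  -- frozen plays the role of the conditional expectation given the past.
  set d : ℕ → (ℕ → Fin N → Fin M → Bool) → (ℕ → Fin N → Fin M → Bool) → ℝ := fun k x y =>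
    φ (η.interval τ k (η.history τ x k) y) -
      ∫ ω', φ (η.interval τ k (η.history τ x k) (channelPath X ω')) ∂μ with hd
  have hdS : ∀ k y, DependsOn (fun x => d k x y) (Finset.range (k * τ) : Set ℕ) := by
    intro k y x x' h
    simp only [hd]
    rw [η.history_congr τ fun n hn => h n (by simpa using hn)]
  have hdT : ∀ k x, DependsOn (d k x) (Finset.Ico (k * τ) (k * τ + τ) : Set ℕ) := by
    intro k x y y' h
    simp only [hd]
    rw [η.interval_congr _ fun n hn => h n (Finset.mem_coe.2 hn)]
  have hdd : ∀ k, DependsOn (fun x => d k x x) (Finset.range (k * τ + τ) : Set ℕ) := by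
    intro k x y h
    have h1 := hdS k x (fun n hn => h n (by simp at hn ⊢; omega) : ∀ n ∈ _, x n = y n)
    have h2 := hdT k y (fun n hn => h n (by simp at hn ⊢; omega) : ∀ n ∈ _, x n = y n)
    exact h1.trans h2
  have hint : ∀ k past, Integrable (fun ω => φ (η.interval τ k past (channelPath X ω))) μ :=
    fun k past => hX.integrable_of_dependsOn (S := Finset.Ico (k * τ) (k * τ + τ))
      (f := fun x => φ (η.interval τ k past x)) fun x y h => by
        simp only
        rw [η.interval_congr _ fun n hn => h n (Finset.mem_coe.2 hn)]
  have hmean : ∀ k x, ∫ ω', d k x (channelPath X ω') ∂μ = 0 := by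
    intro k x
    simp only [hd]
    rw [integral_sub (hint k _) (integrable_const _)]
    simp
  refine ae_tendsto_average_of_orthogonal (D := fun k ω => d k (channelPath X ω) (channelPath X ω))
    (c := 2 * c) (fun k => hX.measurable_of_dependsOn (hdd k)) (fun k ω => ?_) fun k l hl => ?_
  · refine (abs_sub _ _).trans ?_
    have h2 : |∫ ω', φ (η.interval τ k (η.history τ (channelPath X ω) k) (channelPath X ω')) ∂μ|
        ≤ c := by
      refine (abs_integral_le_integral_abs).trans ?_
      refine (integral_mono (hint k _).abs (integrable_const c) fun ω' => hφ _).trans ?_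
      simp
    linarith [hφ (η.interval τ k (η.history τ (channelPath X ω) k) (channelPath X ω))]
  · have hle : l * τ + τ ≤ k * τ := by
      rw [← Nat.succ_mul]; exact Nat.mul_le_mul_right τ hl
    -- The earlier difference `d l` is determined by the slots before interval `k`, so it is a
    -- constant factor when interval `k` is integrated out, and `d k` has mean zero there.
    have h := hX.integral_eq_integral_integral (S := Finset.range (k * τ))
      (T := Finset.Ico (k * τ) (k * τ + τ)) (F := fun x y => d k x y * d l x x)
      (by rw [Finset.disjoint_left]; intro a; simp; omega)
      (fun y x x' hxx => by
        have h1 := hdS k y hxx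
        have h2 := hdd l (fun n hn => hxx n (by simp at hn ⊢; omega) : ∀ n ∈ _, x n = x' n)
        simp only at h1 h2 ⊢
        rw [h1, h2])
      (fun x y y' h => by simp only; rw [hdT k x h])
    rw [h]
    simp_rw [integral_mul_const, hmean]
    simp

theorem IsErasureNetwork.map_channel (hX : IsErasureNetwork μ p X) (n n' : ℕ) (i : Fin N)
    (j : Fin M) : μ.map (X n i j) = μ.map (X n' i j) := by
  have h1 := Measure.isProbabilityMeasure_map (μ := μ) (hX.measurable n i j).aemeasurable
  have h2 := Measure.isProbabilityMeasure_map (μ := μ) (hX.measurable n' i j).aemeasurable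
  have ht : ∀ m, μ.map (X m i j) {true} = ENNReal.ofReal (p i j) := fun m => by
    rw [Measure.map_apply (hX.measurable m i j) (MeasurableSet.singleton _), ← hX.success m i j]
    rfl
  have hf : ∀ m, μ.map (X m i j) {false} = 1 - ENNReal.ofReal (p i j) := fun m => by
    have := Measure.isProbabilityMeasure_map (μ := μ) (hX.measurable m i j).aemeasurable
    rw [← ht m, ← prob_compl_eq_one_sub (MeasurableSet.singleton _)]
    congr 1
    ext b
    cases b <;> simp
  refine Measure.ext_of_singleton fun b => ?_
  cases b
  · rw [hf, hf]
  · rw [ht, ht]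

/-- The channels are stationary. -/
theorem IsErasureNetwork.integral_shift (hX : IsErasureNetwork μ p X) (a : ℕ) {τ : ℕ}
    {f : (ℕ → Fin N → Fin M → Bool) → ℝ} (hf : DependsOn f (Finset.range τ : Set ℕ)) :
    ∫ ω, f (fun t => channelPath X ω (a + t)) ∂μ = ∫ ω, f (channelPath X ω) ∂μ := by
  set W : ℕ → Ω → (Fin τ × Fin N × Fin M → Bool) := fun a ω s => X (a + s.1) s.2.1 s.2.2 ω
  have hW : ∀ a, Measurable (W a) := fun a =>
    measurable_pi_lambda _ fun s => hX.measurable _ _ _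
  -- By independence the law of a block of `τ` slots is the product of its marginals, and these do
  -- not depend on the starting slot.
  have hlaw : ∀ a, μ.map (W a) =
      Measure.pi fun s : Fin τ × Fin N × Fin M => μ.map (X s.1 s.2.1 s.2.2) := by
    intro a
    have hind : iIndepFun (fun s : Fin τ × Fin N × Fin M => X (a + s.1) s.2.1 s.2.2) μ :=
      hX.indep.precomp (g := fun s : Fin τ × Fin N × Fin M => (a + (s.1 : ℕ), s.2.1, s.2.2))
        (fun s s' h => by
          simp only [Prod.mk.injEq] at h
          ext1
          · ext; omega
          · ext1
            exacts [h.2.1, h.2.2])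
    rw [iIndepFun_iff_map_fun_eq_pi_map fun s => (hX.measurable _ _ _).aemeasurable] at hind
    refine hind.trans ?_
    congr 1
    funext s
    exact hX.map_channel _ _ _ _
  set f' : (Fin τ × Fin N × Fin M → Bool) → ℝ := fun b =>
    f fun n i j => if h : n < τ then b (⟨n, h⟩, i, j) else false
  have hff : ∀ a ω, f (fun t => channelPath X ω (a + t)) = f' (W a ω) := by
    intro a ω
    refine hf fun n hn => ?_
    have hn' : n < τ := by simpa using hn
    funext i j
    simp [channelPath, hn', W]
  have hint : ∀ a, ∫ ω, f (fun t => channelPath X ω (a + t)) ∂μ =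
      ∫ b, f' b ∂(Measure.pi fun s : Fin τ × Fin N × Fin M => μ.map (X s.1 s.2.1 s.2.2)) := by
    intro a
    simp_rw [hff]
    rw [← hlaw a, integral_map (hW a).aemeasurable
      (measurable_of_countable _).aestronglyMeasurable]
  rw [hint a, ← hint 0]
  simp

end Averages

/-! ### Almost sure limits superior -/

/-- The condition `0 ≤ c` covers the case of no admissible `R`, where the real `sSup` takes the
value `0`. -/
theorem asLimsup_le {Ω : Type*} [MeasurableSpace Ω] {μ : Measure Ω} [IsProbabilityMeasure μ]
    {f : ℕ → Ω → ℝ} {c : ℝ} (hc : 0 ≤ c)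
    (h : ∀ᵐ ω ∂μ, limsup (fun r => f r ω) atTop ≤ c) : asLimsup μ f ≤ c := by
  refine Real.sSup_le (fun R hR => ?_) hc
  obtain ⟨ω, h1, h2⟩ := (h.and hR).exists
  exact h2.trans h1

theorem asLimsup_eq {Ω : Type*} [MeasurableSpace Ω] {μ : Measure Ω} [IsProbabilityMeasure μ]
    {f : ℕ → Ω → ℝ} {c : ℝ} (h : ∀ᵐ ω ∂μ, Tendsto (fun r => f r ω) atTop (nhds c)) :
    asLimsup μ f = c := by
  have : {R : ℝ | ∀ᵐ ω ∂μ, R ≤ limsup (fun r => f r ω) atTop} = Set.Iic c := by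
    ext R
    constructor
    · intro hR
      obtain ⟨ω, h1, h2⟩ := (h.and hR).exists
      exact h2.trans_eq h1.limsup_eq
    · intro hR
      filter_upwards [h] with ω hω
      rw [hω.limsup_eq]
      exact hR
  rw [asLimsup, this, csSup_Iic]

/-! ### Deliveries and transmissions -/

/-- The indicator of the delivery of a packet. -/
def deliveredInd {N M : ℕ} (j : Fin M) (l : List (SlotRecord N M)) : ℝ :=
  if Delivered l j then 1 else 0

theorem deliveredInd_nonneg {N M : ℕ} (j : Fin M) (l : List (SlotRecord N M)) :
    0 ≤ deliveredInd j l := by unfold deliveredInd; split_ifs <;> norm_num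

theorem deliveredInd_le_one {N M : ℕ} (j : Fin M) (l : List (SlotRecord N M)) :
    deliveredInd j l ≤ 1 := by unfold deliveredInd; split_ifs <;> norm_num

theorem delivered_append_singleton {N M : ℕ} (l : List (SlotRecord N M)) (s : SlotRecord N M)
    (j : Fin M) : Delivered (l ++ [s]) j ↔ Delivered l j ∨ ∃ i, s i = some (j, true) := by
  simp only [Delivered, List.mem_append, List.mem_singleton]
  constructor
  · rintro ⟨s', h | rfl, h'⟩
    exacts [Or.inl ⟨s', h, h'⟩, Or.inr h']
  · rintro (⟨s', h, h'⟩ | h)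
    exacts [⟨s', Or.inl h, h'⟩, ⟨s, Or.inr rfl, h⟩]

theorem delivery_eq {N M : ℕ} (η : SchedulingPolicy N M) (τ : ℕ) (x : ℕ → Fin N → Fin M → Bool)
    (k : ℕ) (j : Fin M) :
    (η.delivery τ x k j : ℝ) = deliveredInd j (η.interval τ k (η.history τ x k) x) := by
  unfold SchedulingPolicy.delivery deliveredInd SchedulingPolicy.interval
  split_ifs <;> simp

namespace SchedulingPolicy

variable {N M : ℕ} (η : SchedulingPolicy N M)

/-- The indicator of a transmission of the packet of client `j` by access point `i` in
time-slot `t` of an interval. -/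
def transmitInd (past : List (IntervalRecord N M)) (x : ℕ → Fin N → Fin M → Bool) (t : ℕ)
    (i : Fin N) (j : Fin M) : ℝ :=
  if η.transmit past (η.assign past) (η.runInterval past x t) i = some j then 1 else 0

theorem transmitInd_nonneg (past : List (IntervalRecord N M)) (x : ℕ → Fin N → Fin M → Bool)
    (t : ℕ) (i : Fin N) (j : Fin M) : 0 ≤ η.transmitInd past x t i j := by
  unfold transmitInd; split_ifs <;> norm_num

theorem sum_transmitInd_le_one (past : List (IntervalRecord N M))
    (x : ℕ → Fin N → Fin M → Bool) (t : ℕ) (i : Fin N) :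
    ∑ j, η.transmitInd past x t i j ≤ 1 := by
  unfold transmitInd
  cases h : η.transmit past (η.assign past) (η.runInterval past x t) i with
  | none => simp
  | some j => simp

theorem deliveredInd_runInterval_succ (past : List (IntervalRecord N M))
    (x : ℕ → Fin N → Fin M → Bool) (t : ℕ) (j : Fin M) :
    deliveredInd j (η.runInterval past x (t + 1)) = deliveredInd j (η.runInterval past x t) +
      ∑ i, η.transmitInd past x t i j * (if x t i j then 1 else 0) := by
  have hiff : Delivered (η.runInterval past x (t + 1)) j ↔ Delivered (η.runInterval past x t) j ∨
      ∃ i, η.transmit past (η.assign past) (η.runInterval past x t) i = some j ∧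
        x t i j = true := by
    rw [runInterval, delivered_append_singleton]
    refine or_congr_right (exists_congr fun i => ?_)
    simp only [Option.map_eq_some_iff, Prod.mk.injEq]
    constructor
    · rintro ⟨a, h1, rfl, h2⟩
      exact ⟨h1, h2⟩
    · rintro ⟨h1, h2⟩
      exact ⟨j, h1, rfl, h2⟩
  have htr := fun i => η.transmit_pending past (η.assign past) (η.runInterval past x t) i j
  by_cases hd : Delivered (η.runInterval past x t) j
  · rw [Finset.sum_eq_zero]
    · simp [deliveredInd, hiff, hd]
    · intro i _
      rw [transmitInd, if_neg fun h => (htr i h).2 hd, zero_mul]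
  · rw [Finset.sum_eq_single (η.assign past j)]
    · simp only [deliveredInd, hiff, hd, false_or, if_false, zero_add, transmitInd]
      by_cases h : η.transmit past (η.assign past) (η.runInterval past x t)
          (η.assign past j) = some j ∧ x t (η.assign past j) j = true
      · rw [if_pos ⟨_, h⟩, if_pos h.1, if_pos h.2, mul_one]
      · rw [if_neg]
        · rcases not_and_or.1 h with h | h
          · rw [if_neg h, zero_mul]
          · rw [if_neg h, mul_zero]
        · rintro ⟨i, h1, h2⟩
          obtain rfl := (htr i h1).1
          exact h ⟨h1, h2⟩
    · intro i _ hi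
      rw [transmitInd, if_neg fun h => hi (htr i h).1.symm, zero_mul]
    · simp

theorem deliveredInd_runInterval (past : List (IntervalRecord N M))
    (x : ℕ → Fin N → Fin M → Bool) (t : ℕ) (j : Fin M) :
    deliveredInd j (η.runInterval past x t) =
      ∑ s ∈ Finset.range t, ∑ i, η.transmitInd past x s i j * (if x s i j then 1 else 0) := by
  induction t with
  | zero => simp [runInterval, deliveredInd, Delivered]
  | succ t ih => rw [deliveredInd_runInterval_succ, ih, Finset.sum_range_succ]

theorem transmitInd_congr (past : List (IntervalRecord N M)) {x y : ℕ → Fin N → Fin M → Bool}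
    {t : ℕ} (h : ∀ s < t, x s = y s) (i : Fin N) (j : Fin M) :
    η.transmitInd past x t i j = η.transmitInd past y t i j := by
  rw [transmitInd, transmitInd, η.runInterval_congr past h]

end SchedulingPolicy

/-! ### The linear program bounds the throughput of every policy -/

section Relaxation

variable {Ω : Type*} [MeasurableSpace Ω] {μ : Measure Ω} [IsProbabilityMeasure μ] {N M : ℕ}
  {p : Fin N → Fin M → ℝ} {X : ℕ → Fin N → Fin M → Ω → Bool}

/-- Whatever the past, the expected number of deliveries in an interval is at most the value of
the linear program. -/
theorem IsErasureNetwork.integral_sum_deliveredInd_le (hX : IsErasureNetwork μ p X)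
    (hp : ∀ i j, 0 ≤ p i j ∧ p i j ≤ 1) (η : SchedulingPolicy N M) (τ k : ℕ)
    (past : List (IntervalRecord N M)) {L : ℝ}
    (hL : ∀ y, LPFeasible p τ y → ∑ i, ∑ j, y i j ≤ L) :
    ∫ ω, ∑ j, deliveredInd j (η.interval τ k past (channelPath X ω)) ∂μ ≤ L := by
  set sh : (ℕ → Fin N → Fin M → Bool) → ℕ → Fin N → Fin M → Bool := fun x t => x (k * τ + t)
  set T : ℕ → Fin N → Fin M → Ω → ℝ := fun t i j ω =>
    η.transmitInd past (sh (channelPath X ω)) t i j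
  set V : ℕ → Fin N → Fin M → Ω → ℝ := fun t i j ω =>
    T t i j ω * (if sh (channelPath X ω) t i j then 1 else 0)
  have hTdep : ∀ t i j, DependsOn (fun x => η.transmitInd past (sh x) t i j)
      (Finset.Ico (k * τ) (k * τ + t) : Set ℕ) := fun t i j x y h =>
    η.transmitInd_congr past (fun s hs => h _ (by simp [hs])) i j
  have hTint : ∀ t i j, Integrable (T t i j) μ := fun t i j =>
    hX.integrable_of_dependsOn (hTdep t i j)
  have hVint : ∀ t i j, Integrable (V t i j) μ := fun t i j =>
    hX.integrable_of_dependsOn (S := Finset.Ico (k * τ) (k * τ + t + 1))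
      (f := fun x => η.transmitInd past (sh x) t i j * (if sh x t i j then 1 else 0))
      fun x y h => by
        have h1 := hTdep t i j (fun n hn => h n (by simp at hn ⊢; omega) : ∀ n ∈ _, x n = y n)
        have h2 : sh x t = sh y t := h _ (by simp)
        simp only at h1 ⊢
        rw [h1, h2]
  -- The decision to transmit in slot `t` uses only earlier slots, so it is independent of the
  -- channel in slot `t`.
  have hVT : ∀ t i j, ∫ ω, V t i j ω ∂μ = p i j * ∫ ω, T t i j ω ∂μ := by
    intro t i j
    have h := hX.integral_eq_integral_integral (S := Finset.Ico (k * τ) (k * τ + t))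
      (T := {k * τ + t})
      (F := fun x y => η.transmitInd past (sh x) t i j * (if y (k * τ + t) i j then 1 else 0))
      (by simp)
      (fun y x x' h => by
        have := hTdep t i j h
        simp only at this ⊢
        rw [this])
      (fun x y y' h => by
        simp only
        rw [h (k * τ + t) (by simp)])
    refine h.trans ?_
    have hc := hX.integral_channel hp (k * τ + t) i j fun b => if b then 1 else 0
    simp only [if_true, mul_one, Bool.false_eq_true, if_false, mul_zero, add_zero] at hc
    simp_rw [integral_const_mul, hc, integral_mul_const]
    rw [mul_comm]
  have hdel : ∀ j ω, deliveredInd j (η.interval τ k past (channelPath X ω)) =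
      ∑ t ∈ Finset.range τ, ∑ i, V t i j ω := fun j ω =>
    η.deliveredInd_runInterval past _ τ j
  have hdint : ∀ j, ∫ ω, ∑ t ∈ Finset.range τ, ∑ i, V t i j ω ∂μ =
      ∑ i, p i j * ∑ t ∈ Finset.range τ, ∫ ω, T t i j ω ∂μ := by
    intro j
    rw [integral_finsetSum _ fun t _ => integrable_finsetSum _ fun i _ => hVint t i j]
    simp_rw [integral_finsetSum _ fun i _ => hVint _ i j, hVT]
    rw [Finset.sum_comm]
    simp_rw [Finset.mul_sum]
  -- The bin constraint holds because an access point makes at most one transmission per slot, and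
  -- the client constraint because a packet is delivered at most once.
  have hfeas : LPFeasible p τ fun i j => p i j * ∑ t ∈ Finset.range τ, ∫ ω, T t i j ω ∂μ := by
    have hT0 : ∀ i j, 0 ≤ ∑ t ∈ Finset.range τ, ∫ ω, T t i j ω ∂μ := fun i j =>
      Finset.sum_nonneg fun t _ => integral_nonneg fun ω => η.transmitInd_nonneg _ _ _ _ _
    refine ⟨fun i j => mul_nonneg (hp i j).1 (hT0 i j), fun i j h => by simp [h], fun i => ?_,
      fun j => ?_⟩
    · calc ∑ j, p i j * (∑ t ∈ Finset.range τ, ∫ ω, T t i j ω ∂μ) / p i j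
          ≤ ∑ j, ∑ t ∈ Finset.range τ, ∫ ω, T t i j ω ∂μ := by
            refine Finset.sum_le_sum fun j _ => ?_
            by_cases h : p i j = 0
            · simpa [h] using hT0 i j
            · rw [mul_div_cancel_left₀ _ h]
        _ = ∑ t ∈ Finset.range τ, ∫ ω, ∑ j, T t i j ω ∂μ := by
            rw [Finset.sum_comm]
            refine Finset.sum_congr rfl fun t _ => ?_
            rw [integral_finsetSum _ fun j _ => hTint t i j]
        _ ≤ ∑ t ∈ Finset.range τ, (1 : ℝ) := by
            refine Finset.sum_le_sum fun t _ => ?_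
            refine (integral_mono (integrable_finsetSum _ fun j _ => hTint t i j)
              (integrable_const 1) fun ω => η.sum_transmitInd_le_one _ _ _ _).trans ?_
            simp
        _ = τ := by simp
    · rw [← hdint]
      refine (integral_mono (integrable_finsetSum _ fun t _ => integrable_finsetSum _ fun i _ =>
        hVint t i j) (integrable_const 1) fun ω => ?_).trans (by simp)
      simp only
      rw [← hdel]
      exact deliveredInd_le_one _ _
  simp_rw [hdel]
  rw [integral_finsetSum _ fun j _ => integrable_finsetSum _ fun t _ =>
    integrable_finsetSum _ fun i _ => hVint t i j]
  simp_rw [hdint]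
  rw [Finset.sum_comm]
  exact hL _ hfeas

theorem IsErasureNetwork.totalThroughput_le (hX : IsErasureNetwork μ p X)
    (hp : ∀ i j, 0 ≤ p i j ∧ p i j ≤ 1) (η : SchedulingPolicy N M) (τ : ℕ) {L : ℝ}
    (hL : ∀ y, LPFeasible p τ y → ∑ i, ∑ j, y i j ≤ L) (hL0 : 0 ≤ L) :
    totalThroughput μ τ X η ≤ L := by
  refine asLimsup_le hL0 ?_
  have hb : ∀ l : List (SlotRecord N M), |∑ j, deliveredInd j l| ≤ M := fun l => by
    rw [abs_of_nonneg (Finset.sum_nonneg fun j _ => deliveredInd_nonneg j l)]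
    exact (Finset.sum_le_sum fun j _ => deliveredInd_le_one j l).trans (by simp)
  filter_upwards [hX.ae_tendsto_average_sub η τ (fun l => ∑ j, deliveredInd j l) hb] with ω hω
  have hlim := hω.add_const L
  rw [zero_add] at hlim
  rw [← hlim.limsup_eq]
  -- The average is compared with the averaged deviation plus `L`, which converges to `L`.
  refine limsup_le_limsup (Eventually.mono (eventually_gt_atTop 0) fun r hr => ?_)
    (isCoboundedUnder_le_of_le atTop (x := 0) fun r => by positivity) hlim.isBoundedUnder_le
  have hr' : (0 : ℝ) < r := by exact_mod_cast hr
  rw [← sub_le_iff_le_add, div_sub' hr'.ne', div_le_div_iff_of_pos_right hr',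
    Finset.sum_sub_distrib]
  have : ∑ k ∈ Finset.range r, ∫ ω', ∑ j, deliveredInd j
      (η.interval τ k (η.history τ (channelPath X ω) k) (channelPath X ω')) ∂μ ≤ r * L := by
    refine (Finset.sum_le_sum fun k _ =>
      hX.integral_sum_deliveredInd_le hp η τ k _ hL).trans ?_
    simp
  have heq : ∑ k ∈ Finset.range r, ∑ j, (η.delivery τ (fun n i j => X n i j ω) k j : ℝ) =
      ∑ k ∈ Finset.range r, ∑ j, deliveredInd j
        (η.interval τ k (η.history τ (channelPath X ω) k) (channelPath X ω)) :=
    Finset.sum_congr rfl fun k _ => Finset.sum_congr rfl fun j _ => delivery_eq _ _ _ _ _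
  rw [heq]
  linarith

end Relaxation

/-! ### Static policies -/

theorem staticPolicy_runInterval {N M : ℕ} (A : Assignment N M) (Γ : Fin N → Equiv.Perm (Fin M))
    (past past' : List (IntervalRecord N M)) (x : ℕ → Fin N → Fin M → Bool) (t : ℕ) :
    (staticPolicy A Γ).runInterval past x t = (staticPolicy A Γ).runInterval past' x t := by
  induction t with
  | zero => rfl
  | succ t ih =>
    simp only [SchedulingPolicy.runInterval, ih]
    rfl

section Static

variable {Ω : Type*} [MeasurableSpace Ω] {μ : Measure Ω} [IsProbabilityMeasure μ] {N M : ℕ}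
  {p : Fin N → Fin M → ℝ} {X : ℕ → Fin N → Fin M → Ω → Bool}

/-- The probability that the packet of client `j` is delivered in an interval under a static
policy. -/
noncomputable def deliveryProb (μ : Measure Ω) (τ : ℕ) (X : ℕ → Fin N → Fin M → Ω → Bool)
    (A : Assignment N M) (Γ : Fin N → Equiv.Perm (Fin M)) (j : Fin M) : ℝ :=
  ∫ ω, deliveredInd j ((staticPolicy A Γ).runInterval [] (channelPath X ω) τ) ∂μ

omit [IsProbabilityMeasure μ] in
theorem deliveryProb_nonneg (τ : ℕ) (A : Assignment N M) (Γ : Fin N → Equiv.Perm (Fin M))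
    (j : Fin M) : 0 ≤ deliveryProb μ τ X A Γ j :=
  integral_nonneg fun _ => deliveredInd_nonneg _ _

theorem IsErasureNetwork.ae_tendsto_average_delivery (hX : IsErasureNetwork μ p X) (τ : ℕ)
    (A : Assignment N M) (Γ : Fin N → Equiv.Perm (Fin M)) (j : Fin M) :
    ∀ᵐ ω ∂μ, Tendsto (fun r : ℕ => (∑ k ∈ Finset.range r,
      ((staticPolicy A Γ).delivery τ (fun n i j => X n i j ω) k j : ℝ)) / r) atTop
      (nhds (deliveryProb μ τ X A Γ j)) := by
  have hb : ∀ l : List (SlotRecord N M), |deliveredInd j l| ≤ 1 := fun l => by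
    rw [abs_of_nonneg (deliveredInd_nonneg j l)]
    exact deliveredInd_le_one j l
  filter_upwards [hX.ae_tendsto_average_sub (staticPolicy A Γ) τ (deliveredInd j) hb] with ω hω
  have hlim := hω.add_const (deliveryProb μ τ X A Γ j)
  rw [zero_add] at hlim
  refine hlim.congr' ((eventually_gt_atTop 0).mono fun r hr => ?_)
  have hr' : (r : ℝ) ≠ 0 := by exact_mod_cast hr.ne'
  have hint : ∀ k past, ∫ ω', deliveredInd j
      ((staticPolicy A Γ).interval τ k past (channelPath X ω')) ∂μ =
        deliveryProb μ τ X A Γ j := by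
    intro k past
    -- By stationarity interval `k` can be moved to the start, and a static policy ignores the past.
    rw [deliveryProb, ← hX.integral_shift (k * τ)
      (f := fun x => deliveredInd j ((staticPolicy A Γ).runInterval [] x τ)) fun x y h => by
        simp only
        rw [(staticPolicy A Γ).runInterval_congr [] fun s hs => h s (by simpa using hs)]]
    simp_rw [SchedulingPolicy.interval, staticPolicy_runInterval A Γ past []]
  simp_rw [hint]
  rw [Finset.sum_sub_distrib]
  have heq : ∑ k ∈ Finset.range r,
      ((staticPolicy A Γ).delivery τ (fun n i j => X n i j ω) k j : ℝ) =
      ∑ k ∈ Finset.range r, deliveredInd j ((staticPolicy A Γ).interval τ k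
        ((staticPolicy A Γ).history τ (channelPath X ω) k) (channelPath X ω)) :=
    Finset.sum_congr rfl fun k _ => delivery_eq _ _ _ _ _
  rw [heq]
  field_simp
  simp

theorem IsErasureNetwork.clientThroughput_static (hX : IsErasureNetwork μ p X) (τ : ℕ)
    (A : Assignment N M) (Γ : Fin N → Equiv.Perm (Fin M)) (j : Fin M) :
    clientThroughput μ τ X (staticPolicy A Γ) j = deliveryProb μ τ X A Γ j :=
  asLimsup_eq (hX.ae_tendsto_average_delivery τ A Γ j)

theorem IsErasureNetwork.throughputNorm_static (hX : IsErasureNetwork μ p X) (τ : ℕ)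
    (A : Assignment N M) (Γ : Fin N → Equiv.Perm (Fin M)) :
    throughputNorm μ τ X (staticPolicy A Γ) = ∑ j, deliveryProb μ τ X A Γ j :=
  Finset.sum_congr rfl fun j _ => by
    rw [hX.clientThroughput_static, abs_of_nonneg (deliveryProb_nonneg τ A Γ j)]

theorem IsErasureNetwork.totalThroughput_static (hX : IsErasureNetwork μ p X) (τ : ℕ)
    (A : Assignment N M) (Γ : Fin N → Equiv.Perm (Fin M)) :
    totalThroughput μ τ X (staticPolicy A Γ) = ∑ j, deliveryProb μ τ X A Γ j := by
  refine asLimsup_eq ?_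
  filter_upwards [ae_all_iff.2 fun j => hX.ae_tendsto_average_delivery τ A Γ j] with ω hω
  refine (tendsto_finsetSum Finset.univ fun j _ => hω j).congr fun r => ?_
  rw [Finset.sum_comm, Finset.sum_div]

end Static

/-! ### The service of one access point under a static policy -/

/-- The clients of access point `i` in the order of service. -/
def serviceList {N M : ℕ} (A : Assignment N M) (Γ : Fin N → Equiv.Perm (Fin M)) (i : Fin N) :
    List (Fin M) :=
  (List.ofFn (Γ i)).filter fun j => decide (A j = i)

/-- The clients in a list whose packets are pending. -/
def pending {N M : ℕ} (l : List (Fin M)) (cur : List (SlotRecord N M)) : List (Fin M) :=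
  l.filter fun j => decide (¬ Delivered cur j)

theorem mem_serviceList {N M : ℕ} {A : Assignment N M} {Γ : Fin N → Equiv.Perm (Fin M)}
    {i : Fin N} {j : Fin M} : j ∈ serviceList A Γ i ↔ A j = i := by
  simp only [serviceList, List.mem_filter, List.mem_ofFn, decide_eq_true_eq, and_iff_right_iff_imp]
  exact fun _ => (Γ i).surjective j

theorem nodup_serviceList {N M : ℕ} (A : Assignment N M) (Γ : Fin N → Equiv.Perm (Fin M))
    (i : Fin N) : (serviceList A Γ i).Nodup :=
  (List.nodup_ofFn.2 (Γ i).injective).filter _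

theorem IsGreedy.pairwise_serviceList {N M : ℕ} {p : Fin N → Fin M → ℝ} {A : Assignment N M}
    {Γ : Fin N → Equiv.Perm (Fin M)} (hΓ : IsGreedy p A Γ) (i : Fin N) :
    (serviceList A Γ i).Pairwise fun a b => p i b ≤ p i a := by
  rw [serviceList, List.pairwise_filter, List.pairwise_ofFn]
  intro a b hab ha hb
  exact hΓ i a b hab (by simpa using ha) (by simpa using hb)

/-- As `l` is an initial segment of the order of service, its first pending client precedes every
pending client outside `l`. The service of `l` can thus be followed without regard to later clients.
-/
theorem staticPolicy_transmit_of_pending {N M : ℕ} {A : Assignment N M}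
    {Γ : Fin N → Equiv.Perm (Fin M)} {i : Fin N} {l r : List (Fin M)} {j : Fin M}
    (hl : l <+: serviceList A Γ i) (past : List (IntervalRecord N M))
    {cur : List (SlotRecord N M)} (h : pending l cur = j :: r) :
    (staticPolicy A Γ).transmit past A cur i = some j := by
  obtain ⟨l', hl'⟩ := hl
  have h1 : (List.ofFn (Γ i)).filter (fun j => decide (A j = i ∧ ¬ Delivered cur j)) =
      pending l cur ++ pending l' cur := by
    rw [pending, pending, ← List.filter_append, hl', serviceList, List.filter_filter]
    refine List.filter_congr fun a _ => ?_
    rw [Bool.decide_and, Bool.and_comm]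
  change (List.ofFn (Γ i)).find? (fun j => decide (A j = i ∧ ¬ Delivered cur j)) = some j
  rw [← List.head?_filter, h1, h]
  rfl

theorem pending_append_singleton {N M : ℕ} (l : List (Fin M)) (cur : List (SlotRecord N M))
    (s : SlotRecord N M) : pending l (cur ++ [s]) =
      (pending l cur).filter fun j => decide (¬ ∃ i, s i = some (j, true)) := by
  rw [pending, pending, List.filter_filter]
  refine List.filter_congr fun a _ => ?_
  rw [← Bool.decide_and, decide_eq_decide, delivered_append_singleton, not_or, and_comm]

theorem pending_runInterval_succ_of_nil {N M : ℕ} (η : SchedulingPolicy N M) {l : List (Fin M)}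
    (past : List (IntervalRecord N M)) (x : ℕ → Fin N → Fin M → Bool) {t : ℕ}
    (h : pending l (η.runInterval past x t) = []) :
    pending l (η.runInterval past x (t + 1)) = [] := by
  rw [SchedulingPolicy.runInterval, pending_append_singleton, h, List.filter_nil]

theorem pending_runInterval_succ_of_cons {N M : ℕ} {A : Assignment N M}
    {Γ : Fin N → Equiv.Perm (Fin M)} {i : Fin N} {l r : List (Fin M)} {j : Fin M}
    (hl : l <+: serviceList A Γ i) (past : List (IntervalRecord N M))
    (x : ℕ → Fin N → Fin M → Bool) {t : ℕ}
    (h : pending l ((staticPolicy A Γ).runInterval past x t) = j :: r) :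
    pending l ((staticPolicy A Γ).runInterval past x (t + 1)) =
      if x t i j then r else j :: r := by
  have hnd : (j :: r).Nodup := by
    rw [← h]
    exact (((nodup_serviceList A Γ i).sublist hl.sublist)).filter _
  have hmem : ∀ a ∈ j :: r, A a = i := fun a ha => by
    rw [← h] at ha
    exact mem_serviceList.1 (hl.subset (List.mem_of_mem_filter ha))
  have htr := staticPolicy_transmit_of_pending hl past h
  rw [SchedulingPolicy.runInterval, pending_append_singleton, h]
  -- Clients of access point `i` can be served only by `i`, which transmits only the head `j`.
  have hiff : ∀ a ∈ j :: r, (∃ i', ((staticPolicy A Γ).transmit past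
      ((staticPolicy A Γ).assign past) ((staticPolicy A Γ).runInterval past x t) i').map
        (fun j => (j, x t i' j)) = some (a, true)) ↔ a = j ∧ x t i j = true := by
    intro a ha
    constructor
    · rintro ⟨i', hi'⟩
      rw [Option.map_eq_some_iff] at hi'
      obtain ⟨a', h1, h2⟩ := hi'
      rw [Prod.mk.injEq] at h2
      obtain ⟨rfl, h2⟩ := h2
      have hA : A a' = i' := ((staticPolicy A Γ).transmit_pending _ _ _ _ _ h1).1
      obtain rfl : i = i' := (hmem _ ha).symm.trans hA
      have h3 : some a' = some j := h1.symm.trans htr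
      obtain rfl := Option.some.inj h3
      exact ⟨rfl, h2⟩
    · rintro ⟨rfl, h2⟩
      exact ⟨i, Option.map_eq_some_iff.2 ⟨a, htr, by rw [h2]⟩⟩
  rw [List.filter_congr (q := fun a => decide (¬ (a = j ∧ x t i j = true))) fun a ha =>
    decide_eq_decide.2 (not_congr (hiff a ha))]
  split_ifs with hx
  · rw [List.filter_cons_of_neg (by simp [hx]), List.filter_eq_self]
    intro a ha
    have : a ≠ j := fun h => (List.nodup_cons.1 hnd).1 (h ▸ ha)
    simp [this]
  · rw [List.filter_eq_self]
    simp [hx]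

/-- A supermartingale for the service of a list of clients: the second moment of the excess of the
time needed to serve the list, if client `j` needs a geometric time of mean `q j`. -/
def potential {M : ℕ} (q : Fin M → ℝ) (a : ℝ) : List (Fin M) → ℝ
  | [] => 0
  | j :: r => ((j :: r).map fun j => q j ^ 2).sum + (((j :: r).map q).sum + a) ^ 2

/-- The untruncated formula dominates also for the empty list, where the potential is cut down to
`0`; this is needed when the last client leaves. -/
theorem potential_le {M : ℕ} (q : Fin M → ℝ) (a : ℝ) (l : List (Fin M)) :
    potential q a l ≤ (l.map fun j => q j ^ 2).sum + ((l.map q).sum + a) ^ 2 := by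
  cases l with
  | nil => simp only [potential, List.map_nil, List.sum_nil]; positivity
  | cons j r => exact le_rfl

/-- With `q = 1 / p j`, a slot adds `1` to `a` and removes `q` from the sum of means with
probability `1 / q`. The base of the square thus has no drift, and its variance adds `q - 1`. The
sum of squares loses `q` on average. The net change of the untruncated formula is `-1`. -/
theorem potential_step {M : ℕ} (p : Fin M → ℝ) (a : ℝ) (j : Fin M) (r : List (Fin M))
    (h0 : 0 < p j) :
    p j * potential (fun j => 1 / p j) (a + 1) r +
      (1 - p j) * potential (fun j => 1 / p j) (a + 1) (j :: r) ≤
        potential (fun j => 1 / p j) a (j :: r) := by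
  have h := mul_le_mul_of_nonneg_left (potential_le (fun j => 1 / p j) (a + 1) r) h0.le
  refine (add_le_add_left h _).trans ?_
  simp only [potential, List.map_cons, List.sum_cons]
  set v := (r.map fun j => (1 / p j) ^ 2).sum
  set m := (r.map fun j => 1 / p j).sum
  have hq : p j * (1 / p j) = 1 := by field_simp
  generalize 1 / p j = q at hq
  have hq1 : (1 - p j) * q ^ 2 = q ^ 2 - q := by
    linear_combination (-q) * hq
  have hq2 : (1 - p j) * q = q - 1 := by linear_combination -hq
  have : p j * (v + (m + (a + 1)) ^ 2) + (1 - p j) * (q ^ 2 + v + (q + m + (a + 1)) ^ 2) =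
      q ^ 2 + v + (q + m + a) ^ 2 - 1 := by
    have e : p j * (v + (m + (a + 1)) ^ 2) + (1 - p j) * (q ^ 2 + v + (q + m + (a + 1)) ^ 2) =
        v + (m + a + 1) ^ 2 + 2 * ((1 - p j) * q ^ 2) + 2 * ((1 - p j) * q) * (m + a + 1) := by
      ring
    rw [e, hq1, hq2]
    ring
  rw [this]
  linarith

/-! ### Chebyshev's inequality through a supermartingale -/

section Service

variable {Ω : Type*} [MeasurableSpace Ω] {μ : Measure Ω} [IsProbabilityMeasure μ] {N M : ℕ}
  {p : Fin N → Fin M → ℝ} {X : ℕ → Fin N → Fin M → Ω → Bool}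

theorem IsErasureNetwork.integral_potential_succ_le (hX : IsErasureNetwork μ p X)
    (hp : ∀ i j, 0 ≤ p i j ∧ p i j ≤ 1) {A : Assignment N M} {Γ : Fin N → Equiv.Perm (Fin M)}
    {i : Fin N} {l : List (Fin M)} (hl : l <+: serviceList A Γ i) (hl0 : ∀ j ∈ l, 0 < p i j)
    (a : ℝ) (t : ℕ) :
    ∫ ω, potential (fun j => 1 / p i j) (a + 1)
        (pending l ((staticPolicy A Γ).runInterval [] (channelPath X ω) (t + 1))) ∂μ ≤
      ∫ ω, potential (fun j => 1 / p i j) a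
        (pending l ((staticPolicy A Γ).runInterval [] (channelPath X ω) t)) ∂μ := by
  set η := staticPolicy A Γ
  set G : List (Fin M) → (ℕ → Fin N → Fin M → Bool) → ℝ := fun l' y => match l' with
    | [] => 0
    | j :: r => potential (fun j => 1 / p i j) (a + 1) (if y t i j then r else j :: r) with hG
  have hrun : ∀ {x y : ℕ → Fin N → Fin M → Bool}, (∀ n ∈ (Finset.range t : Set ℕ), x n = y n) →
      η.runInterval [] x t = η.runInterval [] y t := fun h =>
    η.runInterval_congr [] fun s hs => h s (by simpa using hs)
  have hF : ∀ x, potential (fun j => 1 / p i j) (a + 1) (pending l (η.runInterval [] x (t + 1))) =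
      G (pending l (η.runInterval [] x t)) x := by
    intro x
    cases h : pending l (η.runInterval [] x t) with
    | nil => rw [pending_runInterval_succ_of_nil η [] x h]; rfl
    | cons j r => rw [pending_runInterval_succ_of_cons hl [] x h]
  simp_rw [hF]
  -- The pending list depends on the slots before `t` and the transition only on slot `t`, which is
  -- integrated first.
  have hfr := hX.integral_eq_integral_integral (S := Finset.range t) (T := {t})
    (F := fun x y => G (pending l (η.runInterval [] x t)) y) (by simp)
    (fun y x x' h => by simp only; rw [hrun h])
    (fun x y y' h => by
      have h2 : y t = y' t := h t (by simp)
      simp only [hG, h2])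
  rw [hfr]
  have hinner : ∀ l', ∫ ω', G l' (channelPath X ω') ∂μ = match l' with
      | [] => 0
      | j :: r => p i j * potential (fun j => 1 / p i j) (a + 1) r +
          (1 - p i j) * potential (fun j => 1 / p i j) (a + 1) (j :: r) := by
    intro l'
    cases l' with
    | nil => simp [hG]
    | cons j r =>
      have h := hX.integral_channel hp t i j fun b =>
        potential (fun j => 1 / p i j) (a + 1) (if b then r else j :: r)
      simpa [hG] using h
  refine integral_mono ?_ ?_ fun ω => ?_
  · refine hX.integrable_of_dependsOn (S := Finset.range t)
      (f := fun x => ∫ ω', G (pending l (η.runInterval [] x t)) (channelPath X ω') ∂μ)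
      fun x y h => ?_
    simp only
    rw [hrun h]
  · refine hX.integrable_of_dependsOn (S := Finset.range t)
      (f := fun x => potential (fun j => 1 / p i j) a (pending l (η.runInterval [] x t)))
      fun x y h => ?_
    simp only
    rw [hrun h]
  · simp only
    rw [hinner]
    cases h : pending l (η.runInterval [] (channelPath X ω) t) with
    | nil => simp [potential]
    | cons j r =>
      refine potential_step (p i) a j r (hl0 j ?_)
      have : j ∈ pending l (η.runInterval [] (channelPath X ω) t) := by rw [h]; simp
      exact List.mem_of_mem_filter this

/-- Chebyshev's inequality for the time needed to serve the first clients in the order of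
service. -/
theorem IsErasureNetwork.one_sub_deliveryProb_mul_sq_le (hX : IsErasureNetwork μ p X)
    (hp : ∀ i j, 0 ≤ p i j ∧ p i j ≤ 1) {A : Assignment N M} {Γ : Fin N → Equiv.Perm (Fin M)}
    {i : Fin N} {l : List (Fin M)} (hl : l <+: serviceList A Γ i) (hl0 : ∀ j ∈ l, 0 < p i j)
    {τ : ℕ} (hτ : (l.map fun j => 1 / p i j).sum ≤ τ) {j : Fin M} (hj : j ∈ l) :
    (1 - deliveryProb μ τ X A Γ j) * ((τ : ℝ) - (l.map fun j => 1 / p i j).sum) ^ 2 ≤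
      (l.map fun j => (1 / p i j) ^ 2).sum := by
  set b : ℝ := (τ : ℝ) - (l.map fun j => 1 / p i j).sum with hb
  have hb0 : 0 ≤ b := sub_nonneg.2 hτ
  set η := staticPolicy A Γ
  -- The offset starts at minus the total mean, so the square vanishes at time `0`, and it reaches
  -- the slack `b` at time `τ`.
  have hmono : ∀ t : ℕ, ∫ ω, potential (fun j => 1 / p i j) (b - τ + t)
      (pending l (η.runInterval [] (channelPath X ω) t)) ∂μ ≤
        (l.map fun j => (1 / p i j) ^ 2).sum := by
    intro t
    induction t with
    | zero =>
      have h0 : pending l ([] : List (SlotRecord N M)) = l := by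
        simp [pending, Delivered]
      simp only [SchedulingPolicy.runInterval, h0, Nat.cast_zero, add_zero]
      rw [integral_const]
      refine le_trans (b := potential (fun j => 1 / p i j) (b - τ) l) (by simp)
        ((potential_le _ _ l).trans ?_)
      rw [hb]
      ring_nf
      exact le_rfl
    | succ t ih =>
      refine le_trans ?_ ih
      have := hX.integral_potential_succ_le hp hl hl0 (b - τ + t) t
      simpa only [Nat.cast_add, Nat.cast_one, add_assoc] using this
  have hfin := hmono τ
  rw [sub_add_cancel] at hfin
  refine le_trans ?_ hfin
  have hdep : ∀ {x y : ℕ → Fin N → Fin M → Bool}, (∀ n ∈ (Finset.range τ : Set ℕ), x n = y n) →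
      η.runInterval [] x τ = η.runInterval [] y τ := fun h =>
    η.runInterval_congr [] fun s hs => h s (by simpa using hs)
  have hi1 : Integrable (fun ω => deliveredInd j (η.runInterval [] (channelPath X ω) τ)) μ :=
    hX.integrable_of_dependsOn (S := Finset.range τ)
      (f := fun x => deliveredInd j (η.runInterval [] x τ)) fun x y h => by
        simp only
        rw [hdep h]
  have hi2 : Integrable (fun ω => potential (fun j => 1 / p i j) b
      (pending l (η.runInterval [] (channelPath X ω) τ))) μ :=
    hX.integrable_of_dependsOn (S := Finset.range τ)
      (f := fun x => potential (fun j => 1 / p i j) b (pending l (η.runInterval [] x τ)))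
      fun x y h => by
        simp only
        rw [hdep h]
  have heq : (1 - deliveryProb μ τ X A Γ j) * b ^ 2 =
      ∫ ω, (1 - deliveredInd j (η.runInterval [] (channelPath X ω) τ)) * b ^ 2 ∂μ := by
    rw [integral_mul_const, integral_sub (integrable_const _) hi1]
    simp [deliveryProb, η]
  rw [heq]
  refine integral_mono (((integrable_const _).sub hi1).mul_const _) hi2 fun ω => ?_
  simp only
  have hq : ∀ l' : List (Fin M), 0 ≤ (l'.map fun j => 1 / p i j).sum := fun l' =>
    List.sum_nonneg fun y hy => by
      obtain ⟨j', -, rfl⟩ := List.mem_map.1 hy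
      exact one_div_nonneg.2 (hp i j').1
  have hv : ∀ l' : List (Fin M), 0 ≤ (l'.map fun j => (1 / p i j) ^ 2).sum := fun l' =>
    List.sum_nonneg fun y hy => by
      obtain ⟨j', -, rfl⟩ := List.mem_map.1 hy
      positivity
  set cur := η.runInterval [] (channelPath X ω) τ
  -- If client `j` is undelivered then the pending list is nonempty, and a nonempty list has
  -- potential at least `b ^ 2`.
  cases h : pending l cur with
  | nil =>
    have hd : Delivered cur j := by
      by_contra hd
      have : j ∈ pending l cur := List.mem_filter.2 ⟨hj, by simpa using hd⟩
      rw [h] at this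
      simp at this
    simp [deliveredInd, hd, potential]
  | cons j' r =>
    have h1 := deliveredInd_nonneg j cur
    have h2 := hq (j' :: r)
    have h3 := hv (j' :: r)
    calc (1 - deliveredInd j cur) * b ^ 2 ≤ 1 * b ^ 2 :=
          mul_le_mul_of_nonneg_right (by linarith) (sq_nonneg b)
      _ ≤ (((j' :: r).map fun j => 1 / p i j).sum + b) ^ 2 := by
          rw [one_mul]
          exact pow_le_pow_left₀ hb0 (by linarith) 2
      _ ≤ _ := le_add_of_nonneg_left h3

end Service

/-! ### Counting the deliveries of one access point -/

/-- Replacing a set by an equally large one whose new elements have larger `p` does not increase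
the sum of `1 / p`. -/
theorem sum_one_div_le_of_card_eq {ι : Type*} [DecidableEq ι] {p : ι → ℝ} {T J : Finset ι}
    (hcard : T.card = J.card) (hpos : ∀ j ∈ J, 0 < p j)
    (h : ∀ t ∈ T, ∀ s ∈ J \ T, p s ≤ p t) :
    (∀ t ∈ T, 0 < p t) ∧ ∑ t ∈ T, 1 / p t ≤ ∑ j ∈ J, 1 / p j := by
  have hc : (T \ J).card = (J \ T).card := Finset.card_sdiff_comm hcard
  refine ⟨fun t ht => ?_, ?_⟩
  · by_cases htJ : t ∈ J
    · exact hpos t htJ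
    · have : (J \ T).Nonempty := by
        rw [← Finset.card_pos, ← hc, Finset.card_pos]
        exact ⟨t, Finset.mem_sdiff.2 ⟨ht, htJ⟩⟩
      obtain ⟨s, hs⟩ := this
      exact (hpos s (Finset.mem_sdiff.1 hs).1).trans_le (h t ht s hs)
  · rw [← Finset.sum_inter_add_sum_sdiff T J, ← Finset.sum_inter_add_sum_sdiff J T,
      Finset.inter_comm J T]
    refine add_le_add_right ?_ _
    rcases (J \ T).eq_empty_or_nonempty with he | hne
    · have : T \ J = ∅ := by rw [← Finset.card_eq_zero, hc, he, Finset.card_empty]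
      rw [this, he]
    · obtain ⟨s, hs, hmin⟩ := Finset.exists_min_image (J \ T) (fun j => 1 / p j) hne
      calc ∑ t ∈ T \ J, 1 / p t ≤ (T \ J).card • (1 / p s) :=
            Finset.sum_le_card_nsmul _ _ _ fun t ht =>
              one_div_le_one_div_of_le (hpos s (Finset.mem_sdiff.1 hs).1)
                (h t (Finset.mem_sdiff.1 ht).1 s hs)
        _ = (J \ T).card • (1 / p s) := by rw [hc]
        _ ≤ ∑ j ∈ J \ T, 1 / p j := Finset.card_nsmul_le_sum _ _ _ hmin

theorem sum_map_take_eq_sum_range {ι : Type*} (l : List ι) (j₀ : ι) (g : ι → ℝ) {m : ℕ}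
    (hm : m ≤ l.length) :
    ((l.take m).map g).sum = ∑ k ∈ Finset.range m, g (l.getD k j₀) := by
  induction m with
  | zero => simp
  | succ m ih =>
    rw [List.take_succ_eq_append_getElem hm, List.map_append, List.sum_append,
      ih (Nat.le_of_succ_le hm), Finset.sum_range_succ, List.getD_eq_getElem _ _ hm]
    simp

/-- The number of the packets lost, if the loss probabilities decay as given by Chebyshev's
inequality. -/
theorem sum_le_of_mul_sq_le {n : ℕ} {d : ℕ → ℝ} (h1 : ∀ k < n, d k ≤ 1)
    (h2 : ∀ k < n, d k * (k : ℝ) ^ 2 ≤ n - k) {c : ℝ} (hc : 1 ≤ c) :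
    ∑ k ∈ Finset.range n, d k ≤ 1 + c + (n - 3 / 4) / c := by
  have hc0 : 0 < c := by linarith
  rcases Nat.eq_zero_or_pos n with rfl | hn
  · simp only [Finset.range_zero, Finset.sum_empty, Nat.cast_zero, zero_sub]
    have : (3 / 4 : ℝ) / c ≤ 3 / 4 / 1 := by gcongr
    rw [neg_div]
    linarith
  rcases Nat.eq_or_lt_of_le (Nat.succ_le_of_lt hn) with rfl | hn2
  · have := h1 0 one_pos
    have h3 : 0 ≤ (1 / 4 : ℝ) / c := by positivity
    norm_num
    norm_num at h3
    linarith
  -- The loss is bounded by `1` for the `K + 1` indices up to `√n`. Beyond, `n / m ^ 2` is bounded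
  -- by the telescoping `n * (1 / (m - 1) - 1 / m)`.
  set K := Nat.sqrt n
  have hK : 1 ≤ K := Nat.sqrt_pos.2 hn
  have hKn : K + 1 ≤ n := Nat.sqrt_lt_self hn2
  have hK1 : K * K ≤ n := Nat.sqrt_le n
  have hK2 : n ≤ K * K + K + K := Nat.sqrt_le_add n
  have hK0 : (0 : ℝ) < K := by exact_mod_cast hK
  have hsum : ∀ m, K + 1 ≤ m → m ≤ n →
      ∑ k ∈ Finset.range m, d k ≤ K + 1 + n * (1 / (K : ℝ) - 1 / ((m : ℝ) - 1)) := by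
    intro m hm
    induction m, hm using Nat.le_induction with
    | base =>
      intro _
      have : ∑ k ∈ Finset.range (K + 1), d k ≤ ∑ k ∈ Finset.range (K + 1), (1 : ℝ) :=
        Finset.sum_le_sum fun k hk => h1 k (by have := Finset.mem_range.1 hk; omega)
      simpa using this
    | succ m hm ih =>
      intro hmn
      have h3 := ih (by omega)
      have h4 := h2 m (by omega)
      have hm1 : (1 : ℝ) < m := by exact_mod_cast (by omega : 1 < m)
      have h5 : d m ≤ n * (1 / ((m : ℝ) - 1) - 1 / m) := by
        have h6 : (1 : ℝ) / (m - 1) - 1 / m = 1 / ((m - 1) * m) := by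
          have : (m : ℝ) - 1 ≠ 0 := by linarith
          field_simp
          ring
        have h7 : d m * (m : ℝ) ^ 2 ≤ n := by linarith
        have h8 : 0 < ((m : ℝ) - 1) * m := mul_pos (by linarith) (by linarith)
        rw [h6, mul_one_div, le_div_iff₀ h8]
        by_cases hd : 0 ≤ d m
        · nlinarith
        · have : d m * (((m : ℝ) - 1) * m) ≤ 0 :=
            mul_nonpos_of_nonpos_of_nonneg (by linarith) h8.le
          exact this.trans (Nat.cast_nonneg n)
      rw [Finset.sum_range_succ]
      push_cast
      rw [add_sub_cancel_right]
      linarith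
  refine (hsum n hKn le_rfl).trans ?_
  have hn1 : (1 : ℝ) < n := by exact_mod_cast hn2
  have h3 : (1 : ℝ) ≤ n * (1 / ((n : ℝ) - 1)) := by
    rw [mul_one_div, le_div_iff₀ (by linarith)]
    linarith
  set s : ℝ := K + n / K - 1 with hs
  -- This follows from `K ^ 2 ≤ n ≤ K ^ 2 + 2 * K` and `1 ≤ K`, and is the source of the constant `3
  -- / 4`: the next inequality needs `s ^ 2 / 4 ≤ n - 3 / 4`, by completing the square in `c`.
  have hs2 : s ^ 2 ≤ 4 * n - 3 := by
    have e : s = (K ^ 2 + n - K) / K := by rw [hs]; field_simp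
    rw [e, div_pow, div_le_iff₀ (by positivity)]
    have ha : (K : ℝ) * K ≤ n := by exact_mod_cast hK1
    have hb : (n : ℝ) ≤ K * K + K + K := by exact_mod_cast hK2
    have hK1' : (1 : ℝ) ≤ K := by exact_mod_cast hK
    nlinarith [mul_nonneg (sub_nonneg.2 ha) (sub_nonneg.2 hb),
      mul_nonneg (sq_nonneg (K : ℝ)) (sub_nonneg.2 hK1')]
  have hcs : s ≤ c + (n - 3 / 4) / c := by
    rw [← sub_le_iff_le_add', le_div_iff₀ hc0]
    nlinarith [sq_nonneg (c - s / 2)]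
  have : (n : ℝ) * (1 / K - 1 / (n - 1)) = n / K - n * (1 / (n - 1)) := by ring
  rw [this]
  linarith

/-! ### Packets lost by a greedy access point -/

section Greedy

variable {Ω : Type*} [MeasurableSpace Ω] {μ : Measure Ω} [IsProbabilityMeasure μ] {N M : ℕ}
  {p : Fin N → Fin M → ℝ} {X : ℕ → Fin N → Fin M → Ω → Bool}

/-- If clients `J` of access point `i` fit into its bin, then it delivers almost `|J|` packets. -/
theorem IsErasureNetwork.card_sub_le_sum_deliveryProb (hX : IsErasureNetwork μ p X)
    (hp : ∀ i j, 0 ≤ p i j ∧ p i j ≤ 1) {A : Assignment N M} {Γ : Fin N → Equiv.Perm (Fin M)}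
    (hΓ : IsGreedy p A Γ) {i : Fin N} {τ : ℕ} {J : Finset (Fin M)} (hJA : ∀ j ∈ J, A j = i)
    (hJ0 : ∀ j ∈ J, 0 < p i j) (hJτ : ∑ j ∈ J, 1 / p i j ≤ τ) {c : ℝ} (hc : 1 ≤ c) :
    (J.card : ℝ) - (1 + c + (J.card - 3 / 4) / c) ≤
      ∑ j with A j = i, deliveryProb μ τ X A Γ j := by
  set P := deliveryProb μ τ X A Γ with hP
  have hP0 : ∀ j, 0 ≤ P j := deliveryProb_nonneg τ A Γ
  set n := J.card with hn
  rcases J.eq_empty_or_nonempty with hJ | ⟨j₀, hj₀⟩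
  · have hn0 : n = 0 := by rw [hn, hJ, Finset.card_empty]
    have h := sum_le_of_mul_sq_le (n := 0) (d := fun _ => 0) (by simp) (by simp) hc
    simp only [Finset.range_zero, Finset.sum_empty] at h
    rw [hn0]
    have : 0 ≤ ∑ j with A j = i, P j := Finset.sum_nonneg fun j _ => hP0 j
    linarith
  set l := serviceList A Γ i with hl
  have hnd : l.Nodup := nodup_serviceList A Γ i
  have hJl : J ⊆ l.toFinset := fun j hj => List.mem_toFinset.2 (mem_serviceList.2 (hJA j hj))
  have hnl : n ≤ l.length := by
    rw [← List.toFinset_card_of_nodup hnd]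
    exact Finset.card_le_card hJl
  have hndt : (l.take n).Nodup := hnd.sublist (List.take_sublist n l)
  have hpair := hΓ.pairwise_serviceList i
  rw [← hl] at hpair
  -- Exchange argument: the first `n` clients in greedy order take no more room than `J`, so they
  -- fit into the bin as well.
  obtain ⟨hpos, hsum⟩ := sum_one_div_le_of_card_eq (p := p i) (T := (l.take n).toFinset) (J := J)
    (by rw [List.toFinset_card_of_nodup hndt, List.length_take, min_eq_left hnl]) hJ0
    (fun t ht s hs => by
      rw [Finset.mem_sdiff] at hs
      have hs1 : s ∈ l.take n ++ l.drop n := by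
        rw [List.take_append_drop]
        exact List.mem_toFinset.1 (hJl hs.1)
      rw [← List.take_append_drop n l, List.pairwise_append] at hpair
      refine hpair.2.2 t (List.mem_toFinset.1 ht) s ?_
      rcases List.mem_append.1 hs1 with h | h
      · exact absurd (List.mem_toFinset.2 h) hs.2
      · exact h)
  set e : ℕ → Fin M := fun k => l.getD k j₀ with he
  have hel : ∀ k (hk : k < n), e k = l[k]'(hk.trans_le hnl) := fun k hk =>
    List.getD_eq_getElem _ _ (hk.trans_le hnl)
  have het : ∀ m ≤ n, ∀ k < m, e k ∈ l.take m := fun m hm k hk => by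
    rw [hel k (hk.trans_le hm), List.mem_take_iff_getElem]
    exact ⟨k, by omega, rfl⟩
  have hepos : ∀ k < n, 0 < p i (e k) := fun k hk =>
    hpos _ (List.mem_toFinset.2 (het n le_rfl k hk))
  have hmono : ∀ a b, a ≤ b → b < n → 1 / p i (e a) ≤ 1 / p i (e b) := by
    intro a b hab hb
    rcases hab.eq_or_lt with rfl | hab
    · exact le_rfl
    · refine one_div_le_one_div_of_le (hepos b hb) ?_
      rw [hel a (hab.trans hb), hel b hb]
      exact List.pairwise_iff_getElem.1 hpair a b _ _ hab
  have hτ : ∑ k ∈ Finset.range n, 1 / p i (e k) ≤ τ := by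
    rw [← sum_map_take_eq_sum_range l j₀ (fun j => 1 / p i j) hnl, ← List.sum_toFinset _ hndt]
    exact hsum.trans hJτ
  have hcheb : ∀ k < n, (1 - P (e k)) * ((n : ℝ) - 1 - k) ^ 2 ≤ k + 1 := by
    intro k hk
    have hk1 : k + 1 ≤ n := hk
    have hq : 0 < 1 / p i (e k) := one_div_pos.2 (hepos k hk)
    -- The `n - 1 - k` later clients have mean service times at least that of client `k`, which
    -- yields the slack in Chebyshev's inequality.
    have hpre : ∑ s ∈ Finset.range (k + 1), 1 / p i (e s) + ((n : ℝ) - 1 - k) * (1 / p i (e k)) ≤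
        τ := by
      refine le_trans ?_ hτ
      rw [← Finset.sum_range_add_sum_Ico _ hk1]
      refine add_le_add_right ?_ _
      have := Finset.card_nsmul_le_sum (Finset.Ico (k + 1) n) (fun s => 1 / p i (e s))
        (1 / p i (e k)) fun s hs => by
          rw [Finset.mem_Ico] at hs
          exact hmono k s (by omega) hs.2
      rw [Nat.card_Ico, nsmul_eq_mul, Nat.cast_sub hk1] at this
      push_cast at this
      linarith
    have hnk : 0 ≤ (n : ℝ) - 1 - k := by
      have : ((k + 1 : ℕ) : ℝ) ≤ n := by exact_mod_cast hk1
      push_cast at this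
      linarith
    have hch := hX.one_sub_deliveryProb_mul_sq_le hp (l := l.take (k + 1)) (τ := τ)
      (List.take_prefix _ _) (fun j hj => by
        obtain ⟨s, hs, rfl⟩ := List.mem_take_iff_getElem.1 hj
        have hsn : s < n := by omega
        rw [← hel s hsn]
        exact hepos s hsn)
      (by
        rw [sum_map_take_eq_sum_range l j₀ _ (hk1.trans hnl)]
        have := mul_nonneg hnk hq.le
        exact le_trans (le_add_of_nonneg_right this) hpre)
      (het (k + 1) hk1 k (Nat.lt_succ_self k))
    rw [sum_map_take_eq_sum_range l j₀ _ (hk1.trans hnl),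
      sum_map_take_eq_sum_range l j₀ _ (hk1.trans hnl)] at hch
    have hsq : ∑ s ∈ Finset.range (k + 1), (1 / p i (e s)) ^ 2 ≤
        (k + 1) * (1 / p i (e k)) ^ 2 := by
      have := Finset.sum_le_card_nsmul (Finset.range (k + 1)) (fun s => (1 / p i (e s)) ^ 2)
        ((1 / p i (e k)) ^ 2) fun s hs => by
          have hs' : s < k + 1 := Finset.mem_range.1 hs
          exact pow_le_pow_left₀ (one_div_nonneg.2 (hp i (e s)).1) (hmono s k (by omega) hk) 2
      rw [Finset.card_range, nsmul_eq_mul] at this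
      exact_mod_cast this
    by_cases hd : 0 ≤ 1 - P (e k)
    · have h1 : (1 - P (e k)) * (((n : ℝ) - 1 - k) * (1 / p i (e k))) ^ 2 ≤
          (k + 1) * (1 / p i (e k)) ^ 2 := by
        refine le_trans (mul_le_mul_of_nonneg_left (pow_le_pow_left₀ (by positivity) ?_ 2) hd)
          (hch.trans hsq)
        linarith
      rw [mul_pow, ← mul_assoc] at h1
      exact le_of_mul_le_mul_right h1 (by positivity)
    · have : (1 - P (e k)) * ((n : ℝ) - 1 - k) ^ 2 ≤ 0 :=
        mul_nonpos_of_nonpos_of_nonneg (by linarith) (sq_nonneg _)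
      exact this.trans (by positivity)
  -- Counting from the last client turns the bound into `d k * k ^ 2 ≤ n - k`.
  have hloss := sum_le_of_mul_sq_le (n := n) (d := fun k => 1 - P (e (n - 1 - k)))
    (fun k _ => by linarith [hP0 (e (n - 1 - k))])
    (fun k hk => by
      have h := hcheb (n - 1 - k) (by omega)
      have hcast : ((n - 1 - k : ℕ) : ℝ) = n - 1 - k := by
        rw [Nat.cast_sub (by omega), Nat.cast_sub (by omega)]
        simp
      rw [hcast] at h
      have e1 : (n : ℝ) - 1 - (n - 1 - k) = k := by ring
      rw [e1] at h
      linarith) hc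
  rw [Finset.sum_range_reflect (fun k => 1 - P (e k)) n, Finset.sum_sub_distrib] at hloss
  simp only [Finset.sum_const, Finset.card_range, nsmul_eq_mul, mul_one] at hloss
  have hle : ∑ k ∈ Finset.range n, P (e k) ≤ ∑ j with A j = i, P j := by
    rw [← sum_map_take_eq_sum_range l j₀ P hnl, ← List.sum_toFinset _ hndt]
    refine Finset.sum_le_sum_of_subset_of_nonneg (fun j hj => ?_) fun j _ _ => hP0 j
    have : j ∈ l := List.mem_of_mem_take (List.mem_toFinset.1 hj)
    simpa using mem_serviceList.1 this
  linarith

end Greedy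

/-! ### Basic solutions of the linear program -/

theorem LPFeasible.le_one {N M : ℕ} {p : Fin N → Fin M → ℝ} {τ : ℕ} {x : Fin N → Fin M → ℝ}
    (hx : LPFeasible p τ x) (i : Fin N) (j : Fin M) : x i j ≤ 1 :=
  (Finset.single_le_sum (f := fun i => x i j) (fun i _ => hx.nonneg i j)
    (Finset.mem_univ i)).trans (hx.client j)

/-- A basic solution has at most as many nonzero entries as there are bins and tight client
constraints. -/
theorem card_support_le_of_span_eq_top {N M : ℕ} {p : Fin N → Fin M → ℝ} {τ : ℕ}
    {x : Fin N → Fin M → ℝ} (h : Submodule.span ℝ (tightConstraints p τ x) = ⊤) :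
    (Finset.univ.filter fun s : Fin N × Fin M => x s.1 s.2 ≠ 0).card ≤
      N + (Finset.univ.filter fun j : Fin M => ∑ i, x i j = 1).card := by
  classical
  set Z := Finset.univ.filter fun s : Fin N × Fin M => x s.1 s.2 = 0
  set T := Finset.univ.filter fun j : Fin M => ∑ i, x i j = 1
  set G : Finset (Fin N → Fin M → ℝ) :=
    Z.image (fun s i' j' => if i' = s.1 ∧ j' = s.2 then 1 else 0) ∪
      Finset.univ.image (fun (i : Fin N) i' j' => if i' = i then 1 / p i j' else 0) ∪
      T.image (fun j _ j' => if j' = j then 1 else 0)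
  have hsub : tightConstraints p τ x ⊆ (G : Set (Fin N → Fin M → ℝ)) := by
    rintro a ((⟨i, j, hz, rfl⟩ | ⟨i, -, rfl⟩) | ⟨j, ht, rfl⟩)
    · refine Finset.mem_coe.2 (Finset.mem_union_left _ (Finset.mem_union_left _ ?_))
      exact Finset.mem_image.2 ⟨(i, j), by simpa [Z] using hz, rfl⟩
    · refine Finset.mem_coe.2 (Finset.mem_union_left _ (Finset.mem_union_right _ ?_))
      exact Finset.mem_image.2 ⟨i, Finset.mem_univ _, rfl⟩
    · refine Finset.mem_coe.2 (Finset.mem_union_right _ ?_)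
      exact Finset.mem_image.2 ⟨j, by simpa [T] using ht, rfl⟩
  have hG : Submodule.span ℝ (G : Set (Fin N → Fin M → ℝ)) = ⊤ :=
    top_le_iff.1 (h ▸ Submodule.span_mono hsub)
  have h1 := finrank_span_finset_le_card (R := ℝ) G
  rw [Set.finrank, hG, finrank_top, Module.finrank_pi_fintype] at h1
  simp only [Module.finrank_fintype_fun_eq_card, Fintype.card_fin, Finset.sum_const,
    Finset.card_univ, smul_eq_mul] at h1
  -- At least `N * M` constraints must be tight; at most `N` of them are bin constraints, and the
  -- vanishing entries are complementary to the support.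
  have h2 : G.card ≤ Z.card + N + T.card := by
    refine (Finset.card_union_le _ _).trans (add_le_add ((Finset.card_union_le _ _).trans
      (add_le_add Finset.card_image_le (Finset.card_image_le.trans ?_))) Finset.card_image_le)
    simp
  have h3 := Finset.card_filter_add_card_filter_not (s := (Finset.univ : Finset (Fin N × Fin M)))
    (fun s => x s.1 s.2 = 0)
  rw [Finset.card_univ, Fintype.card_prod, Fintype.card_fin, Fintype.card_fin] at h3
  change Z.card + (Finset.univ.filter fun s : Fin N × Fin M => x s.1 s.2 ≠ 0).card = N * M at h3
  omega

/-- All but at most `N` units of a basic solution consist of integral entries. -/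
theorem IsBasicOptimal.sum_le {N M : ℕ} {p : Fin N → Fin M → ℝ} {τ : ℕ}
    {x : Fin N → Fin M → ℝ} (hx : IsBasicOptimal p τ x) :
    ∑ i, ∑ j, x i j ≤ ∑ i, ((Finset.univ.filter fun j => x i j = 1).card : ℝ) + N := by
  classical
  have hsupp := card_support_le_of_span_eq_top hx.basic
  -- A tight client either has an entry `1` or is split over at least two access points. Summed over
  -- clients and combined with the bound on the support, the numbers of tight clients cancel.
  have hcl : ∀ j, ∑ i, x i j + (if ∑ i, x i j = 1 then 1 else 0 : ℝ) ≤
      ∑ i, (if x i j = 1 then 1 else 0 : ℝ) + ∑ i, (if x i j ≠ 0 then 1 else 0 : ℝ) := by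
    intro j
    have hle : ∀ i, x i j ≤ if x i j ≠ 0 then 1 else 0 := fun i => by
      split_ifs with h
      · exact hx.feasible.le_one i j
      · exact (not_not.1 h).le
    have hint0 : ∀ i, (0 : ℝ) ≤ if x i j = 1 then 1 else 0 := fun i => by
      split_ifs <;> norm_num
    have hsum0 : (0 : ℝ) ≤ ∑ i, if x i j = 1 then 1 else 0 :=
      Finset.sum_nonneg fun i _ => hint0 i
    have hsumle := Finset.sum_le_sum fun i (_ : i ∈ Finset.univ) => hle i
    split_ifs with ht
    · by_cases h1 : ∃ i, x i j = 1
      · obtain ⟨i, hi⟩ := h1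
        have := Finset.single_le_sum (f := fun i => if x i j = 1 then (1 : ℝ) else 0)
          (fun i _ => hint0 i) (Finset.mem_univ i)
        simp only [hi, if_true] at this
        linarith
      · push Not at h1
        have h2 : 1 < ∑ i, (if x i j ≠ 0 then 1 else 0 : ℝ) := by
          obtain ⟨i, -, hi⟩ : ∃ i ∈ Finset.univ, x i j ≠ 0 := by
            by_contra! hall
            rw [Finset.sum_eq_zero hall] at ht
            exact zero_ne_one ht
          refine ht.symm.trans_lt (Finset.sum_lt_sum (fun i _ => hle i) ⟨i, Finset.mem_univ i, ?_⟩)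
          rw [if_pos hi]
          exact lt_of_le_of_ne (hx.feasible.le_one i j) (h1 i)
        have h3 : (2 : ℝ) ≤ ∑ i, (if x i j ≠ 0 then 1 else 0 : ℝ) := by
          rw [Finset.sum_boole] at h2 ⊢
          exact_mod_cast h2
        linarith
    · linarith
  have htot := Finset.sum_le_sum fun j (_ : j ∈ Finset.univ) => hcl j
  rw [Finset.sum_add_distrib, Finset.sum_add_distrib, Finset.sum_boole] at htot
  have h1 : ∑ j, ∑ i, (if x i j ≠ 0 then 1 else 0 : ℝ) =
      ((Finset.univ.filter fun s : Fin N × Fin M => x s.1 s.2 ≠ 0).card : ℝ) := by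
    rw [Finset.sum_comm, ← Finset.sum_boole, Fintype.sum_prod_type]
  have h2 : ∑ j, ∑ i, (if x i j = 1 then 1 else 0 : ℝ) =
      ∑ i, ((Finset.univ.filter fun j => x i j = 1).card : ℝ) := by
    rw [Finset.sum_comm]
    exact Finset.sum_congr rfl fun i _ => Finset.sum_boole _ _
  rw [h1, h2, Finset.sum_comm] at htot
  have h3 : ((Finset.univ.filter fun s : Fin N × Fin M => x s.1 s.2 ≠ 0).card : ℝ) ≤
      N + ((Finset.univ.filter fun j : Fin M => ∑ i, x i j = 1).card : ℝ) := by
    exact_mod_cast hsupp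
  linarith

/-! ### Adding up the access points -/

theorem IsErasureNetwork.le_throughputNorm {Ω : Type*} [MeasurableSpace Ω] {μ : Measure Ω}
    [IsProbabilityMeasure μ] {N M τ : ℕ} {p : Fin N → Fin M → ℝ}
    {X : ℕ → Fin N → Fin M → Ω → Bool} (hX : IsErasureNetwork μ p X)
    (hp : ∀ i j, 0 ≤ p i j ∧ p i j ≤ 1) {x : Fin N → Fin M → ℝ} (hx : IsBasicOptimal p τ x)
    {A : Assignment N M} (hA : SuggestedBy x A) {Γ : Fin N → Equiv.Perm (Fin M)}
    (hΓ : IsGreedy p A Γ) {c : ℝ} (hc : 1 ≤ c) :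
    (∑ i, ∑ j, x i j - N) - (N * (1 + c) + (∑ i, ∑ j, x i j - N - 3 / 4 * N) / c) ≤
      throughputNorm μ τ X (staticPolicy A Γ) := by
  have hc0 : 0 < c := by linarith
  set J : Fin N → Finset (Fin M) := fun i => Finset.univ.filter fun j => x i j = 1
  have hJ : ∀ i, ∀ j ∈ J i, x i j = 1 := fun i j hj => (Finset.mem_filter.1 hj).2
  have hpos : ∀ i, ∀ j ∈ J i, 0 < p i j := fun i j hj => by
    refine lt_of_le_of_ne (hp i j).1 fun h => ?_
    have := hx.feasible.no_link i j h.symm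
    rw [hJ i j hj] at this
    exact one_ne_zero this
  have hAP := fun i => hX.card_sub_le_sum_deliveryProb hp hΓ (i := i) (τ := τ) (J := J i)
    (fun j hj => hA i j (by rw [hJ i j hj]; exact Int.floor_one)) (hpos i)
    (by
      refine le_trans ?_ (hx.feasible.bin i)
      -- Writing the numerators `1` as `x i j` exhibits the sum as a part of the bin constraint.
      rw [Finset.sum_congr rfl fun j hj => by rw [← hJ i j hj]]
      exact Finset.sum_le_sum_of_subset_of_nonneg (Finset.subset_univ _) fun j _ _ =>
        div_nonneg (hx.feasible.nonneg i j) (hp i j).1) hc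
  have hsum := Finset.sum_le_sum fun i (_ : i ∈ Finset.univ) => hAP i
  rw [Finset.sum_fiberwise, ← hX.throughputNorm_static] at hsum
  refine le_trans ?_ hsum
  have hn := hx.sum_le
  simp only [Finset.sum_sub_distrib, Finset.sum_add_distrib, ← Finset.sum_div, Finset.sum_const,
    Finset.card_univ, Fintype.card_fin, nsmul_eq_mul]
  set n : ℝ := ∑ i, ((J i).card : ℝ)
  set L : ℝ := ∑ i, ∑ j, x i j
  have hLn : L - N ≤ n := by linarith
  -- The bound increases with the number of integral entries because `1 / c ≤ 1`, so that number may
  -- be replaced by its lower bound `L - N`.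
  have hmono : (L - N - 3 / 4 * N) * (1 - 1 / c) ≤ (n - 3 / 4 * N) * (1 - 1 / c) := by
    refine mul_le_mul_of_nonneg_right (by linarith) ?_
    rw [sub_nonneg, div_le_one hc0]
    exact hc
  have e1 : (L - N - 3 / 4 * N) / c = (L - N - 3 / 4 * N) * (1 / c) := by ring
  have e2 : (n - N * 3 / 4) / c = (n - 3 / 4 * N) * (1 / c) := by ring
  rw [e1, e2]
  linarith

end TimelyThroughput
open TimelyThroughput
theorem corollary2 {Ω : Type*} [MeasurableSpace Ω] (μ : Measure Ω) [IsProbabilityMeasure μ]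
    (N M τ : ℕ) (p : Fin N → Fin M → ℝ) (hp : ∀ i j, 0 ≤ p i j ∧ p i j ≤ 1)
    (X : ℕ → Fin N → Fin M → Ω → Bool) (hX : IsErasureNetwork μ p X)
    (hC : 11 * (N : ℝ) / 4 < capacity μ τ X)
    (x : Fin N → Fin M → ℝ) (hx : IsBasicOptimal p τ x)
    (A : Assignment N M) (hA : SuggestedBy x A)
    (Γ : Fin N → Equiv.Perm (Fin M)) (hΓ : IsGreedy p A Γ) :
    capacity μ τ X - 2 * N - 2 * √(N * (capacity μ τ X - 7 * N / 4)) ≤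
        throughputNorm μ τ X (staticPolicy A Γ) ∧
      throughputNorm μ τ X (staticPolicy A Γ) ≤ capacity μ τ X := by
  set L : ℝ := ∑ i, ∑ j, x i j with hL
  have hL0 : 0 ≤ L :=
    Finset.sum_nonneg fun i _ => Finset.sum_nonneg fun j _ => hx.feasible.nonneg i j
  have hT : ∀ η, totalThroughput μ τ X η ≤ L := fun η =>
    hX.totalThroughput_le hp η τ hx.optimal hL0
  have hCL : capacity μ τ X ≤ L := Real.iSup_le hT hL0
  constructor
  · set C := capacity μ τ X
    -- Without access points the linear program has value `0`, contradicting `0 < C ≤ L`.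
    have hN : (0 : ℝ) < N := by
      rcases Nat.eq_zero_or_pos N with rfl | h
      · simp only [Finset.univ_eq_empty, Finset.sum_empty] at hL
        simp only [CharP.cast_eq_zero, mul_zero, zero_div] at hC
        linarith
      · exact_mod_cast h
    -- This `c` balances `N * c` against `(C - 7 * N / 4) / c`; the assumption on `C` is what makes
    -- it at least `1`.
    set c : ℝ := √((C - 7 * N / 4) / N) with hc
    have hc1 : 1 ≤ c := by
      rw [hc, Real.one_le_sqrt, le_div_iff₀ hN]
      linarith
    have hc0 : 0 < c := by linarith
    have hcc : c * c = (C - 7 * N / 4) / N :=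
      Real.mul_self_sqrt (div_nonneg (by linarith) hN.le)
    have hCc : C - 7 * N / 4 = N * (c * c) := by
      rw [hcc]
      field_simp
    have hsqrt : √(N * (C - 7 * N / 4)) = N * c := by
      rw [hCc, ← Real.sqrt_mul_self (by positivity : 0 ≤ (N : ℝ) * c)]
      congr 1
      ring
    have h := hX.le_throughputNorm hp hx hA hΓ hc1
    rw [← hL] at h
    refine le_trans ?_ h
    rw [hsqrt]
    have hdiv : (L - N - 3 / 4 * N) / c = (L - C) * (1 / c) + N * c := by
      have : L - N - 3 / 4 * N = (L - C) + N * (c * c) := by linarith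
      rw [this]
      field_simp
    -- Replacing `L` by the smaller `C` is harmless: the excess `L - C` enters the bound with the
    -- nonnegative coefficient `1 - 1 / c`.
    have hle : (L - C) * (1 / c) ≤ (L - C) * 1 := by
      refine mul_le_mul_of_nonneg_left ?_ (by linarith)
      rw [div_le_one hc0]
      exact hc1
    rw [hdiv]
    linarith
  · rw [hX.throughputNorm_static, ← hX.totalThroughput_static]
    exact le_ciSup (f := fun η => totalThroughput μ τ X η)
      ⟨L, by rintro _ ⟨η, rfl⟩; exact hT η⟩ (staticPolicy A Γ)
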